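/- Let $n\ge 0$, $k\ge 1$, let $\mathcal X=\{0,1\}^n$ be the feasible set of the unconstrained combinatorial problem (UP), and let $\mathcal U=\{c^1,\dots,c^k\}\subseteq\mathbb R^n$ be a finite uncertainty set. For $c\in\mathbb R^n$ put $\mathrm{opt}(c)=\min_{y\in\mathcal X}c^Ty$, and for $x\in\mathcal X$ let $$Reg(x,\mathcal U)=\max_{c\in\mathcal U}\bigl(c^Tx-\mathrm{opt}(c)\bigr)$$ be the regret of $x$. Then evaluating the regret of a given solution is in $\mathsf P$. More precisely: 1. For all $n\ge 0$, $k\ge 1$, $c^1,\dots,c^k\in\mathbb R^n$ and $x\in\mathcal X$, the minima defining $\mathrm{opt}(c^j)$ and the maximum defining $Reg(x,\mathcal U)$ are attained, and $$Reg(x,\mathcal U)=\max_{j=1,\dots,k}\Bigl(\sum_{i=1}^n c^j_ix_i-\sum_{i=1}^n\min(0,c^j_i)\Bigr).$$ 2. This value can be computed with $O(nk)$ elementary operations: there are one program for a real-number random access machine (unit cost for each addition, subtraction, multiplication or comparison of reals, memory access, jump, and assignment, copy, increment or comparison of an index) and one constant $C$ such that for all $n,k\ge 1$, all $c^1,\dots,c^k\in\mathbb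 R^n$ and all $x\in\mathcal X$, the program, given $n$, $k$, $x$, $c^1,\dots,c^k$, halts after at most $C\,nk$ steps with output $Reg(x,\mathcal U)$. 3. For rational scenarios $c^1,\dots,c^k\in\mathbb Q^n$, all listed explicitly with numerators and denominators written in binary, a Turing machine computes integers $p$ and $q>0$ with $Reg(x,\mathcal U)=p/q$ (in binary) in time polynomial in the length of the input. 4. For the same inputs together with a bound $\beta\in\mathbb Q$, the decision problem whether $Reg(x,\mathcal U)\ge\beta$ is in $\mathsf P$: a Turing machine decides it in time polynomial in the length of the input. -/

import Mathlib

namespace MinmaxRegret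

/-! ### The minmax regret objective -/

/-- The set `{0,1}^n` of all 0-1 vectors, the feasible set of the unconstrained combinatorial
problem (UP). -/
def binaryCube (n : ℕ) : Set (Fin n → ℝ) := {x | ∀ i, x i = 0 ∨ x i = 1}

/-- The optimal value `min {c ⬝ y : y ∈ 𝒳}` of the nominal problem with cost vector `c`. -/
noncomputable def opt {n : ℕ} (𝒳 : Set (Fin n → ℝ)) (c : Fin n → ℝ) : ℝ :=
  sInf ((fun y => ∑ i, c i * y i) '' 𝒳)

/-- The set of all `c ⬝ x - opt c`, where `c` runs through the uncertainty set `𝒰`. -/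
def regretValues {n : ℕ} (𝒳 𝒰 : Set (Fin n → ℝ)) (x : Fin n → ℝ) : Set ℝ :=
  (fun c => ∑ i, c i * x i - opt 𝒳 c) '' 𝒰

/-- The regret `Reg(x, 𝒰) = max {c ⬝ x - opt c : c ∈ 𝒰}` of `x`. -/
noncomputable def regret {n : ℕ} (𝒳 𝒰 : Set (Fin n → ℝ)) (x : Fin n → ℝ) : ℝ :=
  sSup (regretValues 𝒳 𝒰 x)

/-! ### A real random access machine with unit costs

The machine has index registers (natural numbers), arithmetic registers (real numbers) and a
memory whose cells hold real numbers and are addressed through index registers.  On indices it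
can only assign, copy, add one and compare; on reals it can assign a rational constant, add,
subtract, multiply and compare.  Each instruction costs one step. -/

/-- Instructions of the machine. -/
inductive Instr : Type
  /-- index register `a` gets the constant `v` -/
  | idxConst (a v : ℕ)
  /-- index register `a` gets the content of index register `b` -/
  | idxCopy (a b : ℕ)
  /-- index register `a` is increased by one -/
  | idxSucc (a : ℕ)
  /-- arithmetic register `d` gets the constant `q` -/
  | const (d : ℕ) (q : ℚ)
  /-- arithmetic register `d` gets the sum of registers `a` and `b` -/
  | add (d a b : ℕ)
  /-- arithmetic register `d` gets the difference of registers `a` and `b` -/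
  | sub (d a b : ℕ)
  /-- arithmetic register `d` gets the product of registers `a` and `b` -/
  | mul (d a b : ℕ)
  /-- arithmetic register `d` gets the memory cell addressed by index register `p` -/
  | read (d p : ℕ)
  /-- the memory cell addressed by index register `p` gets the content of register `s` -/
  | write (p s : ℕ)
  /-- go to line `l` -/
  | jump (l : ℕ)
  /-- go to line `l` if index register `a` is less than index register `b` -/
  | jumpIdxLt (a b l : ℕ)
  /-- go to line `l` if arithmetic register `a` is less than arithmetic register `b` -/
  | jumpLt (a b l : ℕ)

/-- Configurations of the machine: the current line and the content of all registers and cells. -/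
structure Config : Type where
  line : ℕ
  idx : ℕ → ℕ
  reg : ℕ → ℝ
  mem : ℕ → ℝ

/-- The effect of one instruction. -/
noncomputable def Instr.exec (s : Config) : Instr → Config
  | .idxConst a v => ⟨s.line + 1, Function.update s.idx a v, s.reg, s.mem⟩
  | .idxCopy a b => ⟨s.line + 1, Function.update s.idx a (s.idx b), s.reg, s.mem⟩
  | .idxSucc a => ⟨s.line + 1, Function.update s.idx a (s.idx a + 1), s.reg, s.mem⟩
  | .const d q => ⟨s.line + 1, s.idx, Function.update s.reg d (q : ℝ), s.mem⟩
  | .add d a b => ⟨s.line + 1, s.idx, Function.update s.reg d (s.reg a + s.reg b), s.mem⟩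
  | .sub d a b => ⟨s.line + 1, s.idx, Function.update s.reg d (s.reg a - s.reg b), s.mem⟩
  | .mul d a b => ⟨s.line + 1, s.idx, Function.update s.reg d (s.reg a * s.reg b), s.mem⟩
  | .read d p => ⟨s.line + 1, s.idx, Function.update s.reg d (s.mem (s.idx p)), s.mem⟩
  | .write p r => ⟨s.line + 1, s.idx, s.reg, Function.update s.mem (s.idx p) (s.reg r)⟩
  | .jump l => ⟨l, s.idx, s.reg, s.mem⟩
  | .jumpIdxLt a b l => ⟨if s.idx a < s.idx b then l else s.line + 1, s.idx, s.reg, s.mem⟩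
  | .jumpLt a b l => ⟨if s.reg a < s.reg b then l else s.line + 1, s.idx, s.reg, s.mem⟩

/-- A machine has halted when the current line lies outside the program. -/
def Halted (P : List Instr) (s : Config) : Prop := P[s.line]? = none

/-- One step of the program `P`; a halted configuration does not change. -/
noncomputable def step (P : List Instr) (s : Config) : Config :=
  match P[s.line]? with
  | none => s
  | some instr => instr.exec s

/-- The initial configuration for dimension `n`, the scenarios `c 0, …, c (k - 1)` and the
solution `x`: index registers `0` and `1` hold `n` and `k`, the memory holds the entries of `x`
followed by those of `c 0`, of `c 1`, and so on, and all else is zero. -/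
noncomputable def initConfig {n k : ℕ} (c : Fin k → Fin n → ℝ) (x : Fin n → ℝ) : Config where
  line := 0
  idx a := if a = 0 then n else if a = 1 then k else 0
  reg _ := 0
  mem a :=
    if h : a < n then x ⟨a, h⟩
    else if h' : a - n < k * n then
      c (finProdFinEquiv.symm ⟨a - n, h'⟩).1 (finProdFinEquiv.symm ⟨a - n, h'⟩).2
    else 0

/-- Started in `s`, the program `P` halts after at most `T` steps with the number `v` in
arithmetic register `0`. -/
def OutputsWithin (P : List Instr) (s : Config) (v : ℝ) (T : ℕ) : Prop :=
  ∃ t ≤ T, Halted P ((step P)^[t] s) ∧ ((step P)^[t] s).reg 0 = v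

/-! ### Instances with rational data and their binary encoding -/

/-- An instance of the evaluation problem of (UP) for a finite uncertainty set, with rational
data: the scenarios `c 0, …, c (k - 1)` and the solution to be evaluated, given as a bit
string. -/
structure EvalInstance : Type where
  n : ℕ
  k : ℕ
  k_pos : 0 < k
  c : Fin k → Fin n → ℚ
  x : Fin n → Bool

/-- The regret of the given solution for the given scenarios. -/
noncomputable def EvalInstance.regret (I : EvalInstance) : ℝ :=
  MinmaxRegret.regret (binaryCube I.n) (Set.range fun j i => (I.c j i : ℝ))
    (fun i => if I.x i then 1 else 0)

open Computability in
/-- The fraction `p / q` as a string: a sign bit and `|p|` in binary, then `q` in binary. -/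
def encodeFraction (p : ℤ) (q : ℕ) : List Γ' :=
  [Γ'.bra, Γ'.bit (decide (p < 0))] ++ (encodeNat p.natAbs).map Γ'.bit ++ [Γ'.comma]
    ++ (encodeNat q).map Γ'.bit ++ [Γ'.ket]

open Computability in
/-- A rational number as a string: its reduced fraction. -/
def encodeRat (r : ℚ) : List Γ' := encodeFraction r.num r.den

open Computability in
/-- An instance as a string: the bits of the solution, then every scenario as a bracketed
sequence of rational numbers. -/
def EvalInstance.encode (I : EvalInstance) : List Γ' :=
  (List.ofFn I.x).map Γ'.bit
    ++ (List.ofFn fun j =>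
          [Γ'.bra] ++ (List.ofFn fun i => encodeRat (I.c j i)).flatten ++ [Γ'.ket]).flatten

/-! ### Polynomial time on Turing machines -/

/-- `f` can be computed by a Turing machine in time polynomial in the length of the encoded
input. -/
def PolyTimeComputable {α β Γ₀ Γ₁ : Type} (encIn : α → List Γ₀) (encOut : β → List Γ₁)
    (f : α → β) : Prop :=
  Nonempty (Turing.TM2ComputableInPolyTime encIn encOut f)

open Classical in
/-- The decision problem `L`, with instances encoded by `enc`, is in P. -/
def InP {α Γ : Type} (enc : α → List Γ) (L : α → Prop) : Prop :=
  PolyTimeComputable enc Computability.encodeBool fun a => decide (L a)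

end MinmaxRegret

open MinmaxRegret

/-! Over the full cube the nominal problem decouples into coordinates: a minimiser takes item `i`
exactly if its cost is negative, so `opt c` is the sum of the `min 0 (c i)` (`isLeast_sum_min`). The
regret is thus a maximum of `k` explicit sums. Every summand `c i * x i - min 0 (c i)` is
nonnegative: it is `|c i|` if `x i` differs from the optimal choice and `0` otherwise. Hence a
running maximum may start at `0`, and a number is the regret once it bounds all scenario values and
is either `0` or one of them (`eq_regret`). Both algorithms rest on this.

On the real random access machine, two nested loops with constant work per coefficient suffice;
`RunState` is the loop invariant and `outputsWithin_regretProgram` the result.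

For Turing machines, programs are written in the small stack language `Cmd`. Compilation turns one
step of a program into one machine step (`exec_iterate`), so time bounds can be proved for `Cmd`
alone. Binary addition, multiplication and comparison are built first, then the evaluation of the
regret with unreduced fractions.

The essential point for polynomial time is the size of the fractions. Adding an item multiplies the
denominators, but the bit length grows by at most the length of the item's encoding (`runs_item`).
Taking the larger of two fractions creates no new number (`runs_scenario`). All values therefore
have at most about as many bits as the input, cross products at most twice as many, each arithmetic
operation is quadratic, and the total time is cubic (`runs_evaluate`). The decision problem is
settled by one more cross multiplication. -/

namespace MinmaxRegret

open Computability Turing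

/-! ### A structured language on stacks -/

/-- Structured programs that work on stacks over the alphabet `Γ'`, named by the elements
of `R`. -/
inductive Cmd (R : Type) : Type
  | skip : Cmd R
  /-- push a symbol -/
  | push (r : R) (g : Γ') : Cmd R
  | seq (a b : Cmd R) : Cmd R
  /-- pop a symbol and branch on it -/
  | switch (r : R) (f : Option Γ' → Cmd R) : Cmd R
  /-- repeat as long as the top symbol satisfies a condition -/
  | loop (r : R) (p : Option Γ' → Bool) (c : Cmd R) : Cmd R

namespace Cmd

variable {R : Type}

/-- The labels of the machine that a program is compiled to. -/
def Lab : Cmd R → Type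
  | skip => Unit
  | push _ _ => Unit
  | seq a b => a.Lab ⊕ b.Lab
  | switch _ f => Option (Σ o, (f o).Lab)
  | loop _ _ c => Option c.Lab

/-- The first label of a program. -/
def entry : (c : Cmd R) → c.Lab
  | skip => ()
  | push _ _ => ()
  | seq a _ => Sum.inl a.entry
  | switch _ _ => none
  | loop _ _ _ => none

noncomputable instance instFintypeLab : (c : Cmd R) → Fintype c.Lab
  | skip => inferInstanceAs (Fintype Unit)
  | push _ _ => inferInstanceAs (Fintype Unit)
  | seq a b =>
    haveI := instFintypeLab a
    haveI := instFintypeLab b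
    inferInstanceAs (Fintype (a.Lab ⊕ b.Lab))
  | switch _ f =>
    haveI := fun o => instFintypeLab (f o)
    inferInstanceAs (Fintype (Option (Σ o, (f o).Lab)))
  | loop _ _ c =>
    haveI := instFintypeLab c
    inferInstanceAs (Fintype (Option c.Lab))

/-- The alphabets of the stacks of the compiled machine: one stack over `Γ'` for every stack of
the program, and a stack of Booleans for answers. -/
abbrev Alph : Option R → Type
  | none => Bool
  | some _ => Γ'

/-- The statements of the compiled machine, where `next` is the label reached in the end. -/
def compile {Λ : Type} : (c : Cmd R) → (c.Lab → Λ) → Λ → c.Lab →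
    TM2.Stmt (Alph (R := R)) Λ (Option Γ')
  | skip, _, next, _ => .goto fun _ => next
  | push r g, _, next, _ => .push (some r) (fun _ => g) (.goto fun _ => next)
  | seq a b, emb, _, .inl l =>
    a.compile (fun l => emb (Sum.inl l)) (emb (Sum.inr b.entry)) l
  | seq _ b, emb, next, .inr l => b.compile (fun l => emb (Sum.inr l)) next l
  -- The popped symbol is stored in the internal state, on which the jump then depends; both belong
  -- to a single machine step.
  | switch r f, emb, _, none =>
    .pop (some r) (fun _ o => o) (.goto fun v => emb (some ⟨v, (f v).entry⟩))
  | switch _ f, emb, next, some ⟨o, l⟩ =>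
    (f o).compile (fun l => emb (some ⟨o, l⟩)) next l
  | loop r p c, emb, next, none =>
    .peek (some r) (fun _ o => o) (.goto fun v => if p v then emb (some c.entry) else next)
  | loop _ _ c, emb, _, some l => c.compile (fun l => emb (some l)) (emb none) l

variable [DecidableEq R]

/-- `Exec c s s' t`: the program `c` takes the stacks `s` to `s'` in `t` steps. -/
inductive Exec : Cmd R → (R → List Γ') → (R → List Γ') → ℕ → Prop
  | skip (s) : Exec skip s s 1
  | push (r g s) : Exec (push r g) s (Function.update s r (g :: s r)) 1
  | seq {a b s s₁ s₂ t₁ t₂} : Exec a s s₁ t₁ → Exec b s₁ s₂ t₂ → Exec (seq a b) s s₂ (t₁ + t₂)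
  | switch {r f s s₁ t} : Exec (f (s r).head?) (Function.update s r (s r).tail) s₁ t →
      Exec (switch r f) s s₁ (t + 1)
  | loop_done {r p c s} : p (s r).head? = false → Exec (loop r p c) s s 1
  | loop_step {r p c s s₁ s₂ t₁ t₂} : p (s r).head? = true → Exec c s s₁ t₁ →
      Exec (loop r p c) s₁ s₂ t₂ → Exec (loop r p c) s s₂ (1 + t₁ + t₂)

/-- `Runs c s s' T`: the program `c` takes the stacks `s` to `s'` in at most `T` steps. -/
def Runs (c : Cmd R) (s s' : R → List Γ') (T : ℕ) : Prop := ∃ t ≤ T, Exec c s s' t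

/-- The stacks of the compiled machine. -/
def toStk (s : R → List Γ') : ∀ k : Option R, List (Alph k)
  | none => []
  | some r => s r

theorem update_toStk (s : R → List Γ') (r : R) (l : List Γ') :
    Function.update (toStk s) (some r) l = toStk (Function.update s r l) := by
  funext k
  rcases k with _ | k
  · rfl
  · by_cases h : k = r
    · subst h; simp [toStk]
    · simp [toStk, h]

/-- Step counts agree exactly on both sides. The embedding `emb` of labels into an arbitrary machine
lets the induction pass to subprograms. The internal state `v` is arbitrary because compiled code
overwrites it before reading it. -/
theorem exec_iterate {Λ : Type} (M : Λ → TM2.Stmt (Alph (R := R)) Λ (Option Γ'))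
    {c : Cmd R} {s s' : R → List Γ'} {t : ℕ} (h : Exec c s s' t) :
    ∀ (emb : c.Lab → Λ) (next : Λ), (∀ l, M (emb l) = c.compile emb next l) →
      ∀ v, ∃ v', (flip bind (TM2.step M))^[t] (some ⟨some (emb c.entry), v, toStk s⟩) =
        some ⟨some next, v', toStk s'⟩ := by
  induction h with
  | skip s =>
    intro emb next hM v
    refine ⟨v, ?_⟩
    change some (TM2.stepAux (M (emb ())) v (toStk s)) = _
    rw [hM ()]; rfl
  | push r g s =>
    intro emb next hM v
    refine ⟨v, ?_⟩
    change some (TM2.stepAux (M (emb ())) v (toStk s)) = _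
    rw [hM (), ← update_toStk]; rfl
  | @seq a b s s₁ s₂ t₁ t₂ _ _ ih₁ ih₂ =>
    intro emb next hM v
    obtain ⟨v₁, h₁⟩ := ih₁ (fun l => emb (Sum.inl l)) (emb (Sum.inr b.entry))
      (fun l => hM (Sum.inl l)) v
    obtain ⟨v₂, h₂⟩ := ih₂ (fun l => emb (Sum.inr l)) next (fun l => hM (Sum.inr l)) v₁
    refine ⟨v₂, ?_⟩
    rw [add_comm, Function.iterate_add_apply, ← h₂, ← h₁]; rfl
  | @switch r f s s₁ t _ ih =>
    intro emb next hM v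
    obtain ⟨v₁, h₁⟩ := ih (fun l => emb (some ⟨(s r).head?, l⟩)) next
      (fun l => hM (some ⟨_, l⟩)) (s r).head?
    refine ⟨v₁, ?_⟩
    rw [Function.iterate_succ_apply, ← h₁, ← update_toStk]
    congr 1
    change some (TM2.stepAux (M (emb none)) v (toStk s)) = _
    rw [hM none]; rfl
  | @loop_done r p c s hp =>
    intro emb next hM v
    refine ⟨(s r).head?, ?_⟩
    change some (TM2.stepAux (M (emb none)) v (toStk s)) = _
    rw [hM none]
    change some (TM2.Cfg.mk (some (if p (s r).head? then _ else _)) _ _) = _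
    rw [hp]; rfl
  | @loop_step r p c s s₁ s₂ t₁ t₂ hp _ _ ih₁ ih₂ =>
    intro emb next hM v
    obtain ⟨v₁, h₁⟩ := ih₁ (fun l => emb (some l)) (emb none) (fun l => hM (some l)) (s r).head?
    obtain ⟨v₂, h₂⟩ := ih₂ emb next hM v₁
    refine ⟨v₂, ?_⟩
    rw [show 1 + t₁ + t₂ = t₂ + (t₁ + 1) by ring, Function.iterate_add_apply, ← h₂,
      Function.iterate_succ_apply]
    congr 1
    refine Eq.trans ?_ h₁
    congr 1
    change some (TM2.stepAux (M (emb none)) v (toStk s)) = _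
    rw [hM none]
    change some (TM2.Cfg.mk (some (if p (s r).head? then _ else _)) _ _) = _
    rw [hp]; rfl

/-! ### From programs to Turing machines -/

/-- The machine of the program `c` with input stack `inp` and output stack `out`, which executes
the statement `fin` in the end. -/
noncomputable def machine [Fintype R] (c : Cmd R) (inp : R) (out : Option R)
    (fin : TM2.Stmt (Alph (R := R)) (Option c.Lab) (Option Γ')) : FinTM2 where
  K := Option R
  k₀ := some inp
  k₁ := out
  Γ := Alph
  Λ := Option c.Lab
  main := some c.entry
  σ := Option Γ'
  initialState := none
  Γk₀Fin := inferInstanceAs (Fintype Γ')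
  m l := l.elim fin (c.compile some none)

/-- The stacks that are empty except for `l` on the stack `r`. -/
def single (r : R) (l : List Γ') : R → List Γ' := Function.update (fun _ => []) r l

theorem toStk_single (r : R) (l : List Γ') : toStk (single r l) (some r) = l := by
  simp [toStk, single]

theorem initList_machine [Fintype R] (c : Cmd R) (inp : R) (out : Option R)
    (fin : TM2.Stmt (Alph (R := R)) (Option c.Lab) (Option Γ')) (l : List Γ') :
    initList (machine c inp out fin) l = ⟨some (some c.entry), none, toStk (single inp l)⟩ := by
  unfold initList
  refine congrArg (TM2.Cfg.mk _ _) ?_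
  funext k
  by_cases h : k = some inp
  · subst h
    refine (dif_pos rfl).trans ?_
    rw [toStk_single]; rfl
  · refine (dif_neg h).trans ?_
    rcases k with _ | k
    · rfl
    · have : k ≠ inp := fun e => h (by rw [e])
      simp [toStk, single, this]; rfl

/-- The additional step is the execution of `fin` at the label `none`, which the program reaches at
its end. -/
theorem evalsTo_machine [Fintype R] {c : Cmd R} {inp : R} {out : Option R}
    {fin : TM2.Stmt (Alph (R := R)) (Option c.Lab) (Option Γ')} {l : List Γ'}
    {s : R → List Γ'} {T : ℕ} (h : Runs c (single inp l) s T)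
    (cfg : (machine c inp out fin).Cfg)
    (hfin : ∀ v, TM2.stepAux fin v (toStk s) = cfg) :
    Nonempty (StateTransition.EvalsToInTime (machine c inp out fin).step
      (initList (machine c inp out fin) l) (some cfg) (T + 1)) := by
  obtain ⟨t, ht, hx⟩ := h
  obtain ⟨v, hv⟩ := exec_iterate (machine c inp out fin).m hx some none (fun _ => rfl) none
  refine ⟨⟨⟨t + 1, ?_⟩, Nat.succ_le_succ ht⟩⟩
  rw [Function.iterate_succ_apply', initList_machine, ← hfin v]
  exact congrArg (flip bind (machine c inp out fin).step) hv

theorem polyTimeComputable_of_runs [Fintype R] {α β : Type} {enc : α → List Γ'}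
    {encOut : β → List Γ'} {f : α → β} (c : Cmd R) (inp out : R) (p : Polynomial ℕ)
    (h : ∀ a, Runs c (single inp (enc a)) (single out (encOut (f a)))
      (p.eval (enc a).length)) :
    PolyTimeComputable enc encOut f := by
  -- A halting configuration must carry the initial internal state, so `fin` resets it.
  refine ⟨⟨⟨machine c inp (some out) (.load (fun _ => none) .halt), Equiv.refl Γ',
    Equiv.refl Γ'⟩, p + 1, fun a => Classical.choice ?_⟩⟩
  have := evalsTo_machine (out := some out) (h a)
    (fin := .load (fun _ => none) .halt)
    (haltList (machine c inp (some out) (.load (fun _ => none) .halt)) (encOut (f a))) (by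
      intro v
      unfold haltList
      refine congrArg (TM2.Cfg.mk _ _) ?_
      funext k
      by_cases h : k = some out
      · subst h
        refine Eq.trans ?_ (dif_pos rfl).symm
        rw [toStk_single]; rfl
      · refine Eq.trans ?_ (dif_neg h).symm
        rcases k with _ | k
        · rfl
        · have : k ≠ out := fun e => h (by rw [e])
          simp [toStk, single, this]; rfl)
  have e : ∀ l : List Γ', l.map (Equiv.refl Γ').invFun = l := fun l => List.map_id _
  simp only [TM2OutputsInTime, Polynomial.eval_add, Polynomial.eval_one, Option.map_some]
  erw [e, e]
  exact this

/-- The truth value of a symbol. -/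
def truth : Option Γ' → Bool
  | some (.bit b) => b
  | _ => false

theorem inP_of_runs [Fintype R] {α : Type} {enc : α → List Γ'} {L : α → Prop} (c : Cmd R)
    (inp out : R) (p : Polynomial ℕ) (b : α → Bool) (hb : ∀ a, b a = true ↔ L a)
    (h : ∀ a, Runs c (single inp (enc a)) (single out [Γ'.bit (b a)])
      (p.eval (enc a).length)) :
    InP enc L := by
  -- Answers are encoded over `Bool` and not over `Γ'`; `fin` moves the answer bit to the Boolean
  -- stack.
  set fin : TM2.Stmt (Alph (R := R)) (Option c.Lab) (Option Γ') :=
    .pop (some out) (fun _ o => o) (.push none truth (.load (fun _ => none) .halt)) with hfin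
  refine ⟨⟨⟨machine c inp none fin, Equiv.refl Γ', Equiv.refl Bool⟩, p + 1,
    fun a => Classical.choice ?_⟩⟩
  have := evalsTo_machine (out := none) (h a) (fin := fin)
    (haltList (machine c inp none fin) [b a]) (by
      intro v
      unfold haltList
      simp only [hfin, TM2.stepAux]
      refine congr (congrArg (TM2.Cfg.mk _) rfl) ?_
      erw [update_toStk]
      funext k
      rcases k with _ | k
      · refine Eq.trans ?_ (dif_pos rfl).symm
        simp [toStk, single, truth]; rfl
      · refine Eq.trans ?_ (dif_neg (Option.some_ne_none k)).symm
        by_cases e : k = out <;> (simp [toStk, single, e]; rfl))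
  have e : ∀ l : List Γ', l.map (Equiv.refl Γ').invFun = l := fun l => List.map_id _
  have e' : ∀ l : List Bool, l.map (Equiv.refl Bool).invFun = l := fun l => List.map_id _
  have hd : (@decide (L a) (Classical.propDecidable _)) = b a := by
    rw [Bool.eq_iff_iff, hb]; simp
  simp only [TM2OutputsInTime, Polynomial.eval_add, Polynomial.eval_one, Option.map_some]
  erw [e, e']
  rw [hd]
  exact this

end Cmd
-- Time bounds for elementary stack routines
namespace Cmd

section Routines

variable {R : Type} [DecidableEq R] {s s₁ s₂ : R → List Γ'} {a b c : Cmd R} {T T₁ T₂ : ℕ}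

theorem Runs.mono (h : Runs c s s₁ T₁) (hT : T₁ ≤ T₂) : Runs c s s₁ T₂ := by
  obtain ⟨t, ht, hx⟩ := h
  exact ⟨t, ht.trans hT, hx⟩

theorem Runs.cast (h : Runs c s s₁ T₁) (hs : s₁ = s₂) (hT : T₁ ≤ T₂) : Runs c s s₂ T₂ :=
  hs ▸ h.mono hT

theorem Runs.skip : Runs skip s s 1 := ⟨1, le_rfl, .skip s⟩

theorem Runs.push (r : R) (g : Γ') :
    Runs (push r g) s (Function.update s r (g :: s r)) 1 := ⟨1, le_rfl, .push r g s⟩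

theorem Runs.seq (h₁ : Runs a s s₁ T₁) (h₂ : Runs b s₁ s₂ T₂) :
    Runs (seq a b) s s₂ (T₁ + T₂) := by
  obtain ⟨t₁, ht₁, hx₁⟩ := h₁
  obtain ⟨t₂, ht₂, hx₂⟩ := h₂
  exact ⟨t₁ + t₂, by omega, .seq hx₁ hx₂⟩

theorem Runs.switch {r : R} {f : Option Γ' → Cmd R}
    (h : Runs (f (s r).head?) (Function.update s r (s r).tail) s₁ T) :
    Runs (switch r f) s s₁ (T + 1) := by
  obtain ⟨t, ht, hx⟩ := h
  exact ⟨t + 1, by omega, .switch hx⟩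

theorem Runs.loop_done {r : R} {p : Option Γ' → Bool} (h : p (s r).head? = false) :
    Runs (loop r p c) s s 1 := ⟨1, le_rfl, .loop_done h⟩

theorem Runs.loop_step {r : R} {p : Option Γ' → Bool} (h : p (s r).head? = true)
    (h₁ : Runs c s s₁ T₁) (h₂ : Runs (loop r p c) s₁ s₂ T₂) :
    Runs (loop r p c) s s₂ (1 + T₁ + T₂) := by
  obtain ⟨t₁, ht₁, hx₁⟩ := h₁
  obtain ⟨t₂, ht₂, hx₂⟩ := h₂
  exact ⟨1 + t₁ + t₂, by omega, .loop_step h hx₁ hx₂⟩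

/-- Push the popped symbol, if there is one. -/
def pushSym (r : R) : Option Γ' → Cmd R
  | none => .skip
  | some g => .push r g

/-- Pop and forget a symbol. -/
def drop (r : R) : Cmd R := .switch r fun _ => .skip

theorem runs_drop (r : R) : Runs (drop r) s (Function.update s r (s r).tail) 2 :=
  Runs.switch Runs.skip

/-- Move the longest prefix with the property `p` from the stack `r` to the stack `q`. -/
def moveWhile (p : Option Γ' → Bool) (r q : R) : Cmd R := .loop r p (.switch r (pushSym q))

/-- Each symbol costs three steps (test, pop, push), and the last failing test one more. -/
theorem runs_moveWhile {p : Option Γ' → Bool} {r q : R} (hrq : r ≠ q) (l l' : List Γ')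
    (hl : ∀ g ∈ l, p (some g) = true) (hl' : p l'.head? = false) :
    ∀ s : R → List Γ', s r = l ++ l' → Runs (moveWhile p r q) s
      (Function.update (Function.update s r l') q (l.reverse ++ s q)) (3 * l.length + 1) := by
  induction l with
  | nil =>
    intro s hs
    refine (Runs.loop_done (by simpa [hs] using hl')).cast ?_ le_rfl
    funext x
    simp only [Function.update_apply]
    split_ifs <;> simp_all
  | cons g l ih =>
    intro s hs
    have h₁ : Runs (.switch r (pushSym q)) s
        (Function.update (Function.update s r (l ++ l')) q (g :: s q)) 2 := by
      refine Runs.switch ?_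
      rw [hs]
      refine (Runs.push q g).cast ?_ le_rfl
      simp [hrq.symm]
    refine (Runs.loop_step (by simpa [hs] using hl g (by simp)) h₁
      (ih (fun g hg => hl g (by simp [hg])) _ (by simp [hrq]))).cast ?_
        (by simp only [List.length_cons]; omega)
    funext x
    simp only [Function.update_apply]
    split_ifs <;> simp_all

/-- Move the stack `r` to the stack `q`, in reverse order. -/
def move (r q : R) : Cmd R := moveWhile Option.isSome r q

theorem runs_move {r q : R} (hrq : r ≠ q) : Runs (move r q) s
    (Function.update (Function.update s r []) q ((s r).reverse ++ s q))
      (3 * (s r).length + 1) :=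
  runs_moveWhile hrq (s r) [] (fun _ _ => rfl) rfl s (by simp)

/-- Remove the longest prefix with the property `p` from the stack `r`. -/
def dropWhile (p : Option Γ' → Bool) (r : R) : Cmd R := .loop r p (drop r)

theorem runs_dropWhile {p : Option Γ' → Bool} {r : R} (l l' : List Γ')
    (hl : ∀ g ∈ l, p (some g) = true) (hl' : p l'.head? = false) :
    ∀ s : R → List Γ', s r = l ++ l' → Runs (dropWhile p r) s
      (Function.update s r l') (3 * l.length + 1) := by
  induction l with
  | nil =>
    intro s hs
    refine (Runs.loop_done (by simpa [hs] using hl')).cast ?_ le_rfl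
    rw [List.nil_append] at hs
    simp [← hs]
  | cons g l ih =>
    intro s hs
    refine (Runs.loop_step (by simpa [hs] using hl g (by simp)) (runs_drop r)
      (ih (fun g hg => hl g (by simp [hg])) _ (by simp [hs]))).cast (by simp)
        (by simp only [List.length_cons]; omega)

/-- Empty the stack `r`. -/
def clear (r : R) : Cmd R := dropWhile Option.isSome r

theorem runs_clear (r : R) :
    Runs (clear r) s (Function.update s r []) (3 * (s r).length + 1) :=
  runs_dropWhile (s r) [] (fun _ _ => rfl) rfl s (by simp)

/-- Move the stack `t` to the stacks `r` and `q`, in reverse order. -/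
def unload (t r q : R) : Cmd R :=
  .loop t Option.isSome (.switch t fun o => .seq (pushSym r o) (pushSym q o))

theorem runs_unload {t r q : R} (htr : t ≠ r) (htq : t ≠ q) (hrq : r ≠ q) (l : List Γ') :
    ∀ s : R → List Γ', s t = l → Runs (unload t r q) s
      (Function.update (Function.update (Function.update s t []) r (l.reverse ++ s r)) q
        (l.reverse ++ s q)) (4 * l.length + 1) := by
  induction l with
  | nil =>
    intro s hs
    refine (Runs.loop_done (by simp [hs])).cast ?_ le_rfl
    funext x
    simp only [Function.update_apply]
    split_ifs <;> simp_all
  | cons g l ih =>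
    intro s hs
    have h₁ : Runs (.switch t fun o => .seq (pushSym r o) (pushSym q o)) s
        (Function.update (Function.update (Function.update s t l) r (g :: s r)) q
          (g :: s q)) 3 := by
      refine Runs.switch ?_
      rw [hs]
      refine ((Runs.push r g).seq (Runs.push q g)).cast ?_ le_rfl
      simp [htr.symm, htq.symm, hrq.symm]
    refine (Runs.loop_step (by simp [hs]) h₁ (ih _ (by simp [htr, htq]))).cast ?_
        (by simp only [List.length_cons]; omega)
    funext x
    simp only [Function.update_apply]
    split_ifs <;> simp_all

/-- Move the stack `r` to the stack `q` through the empty stack `t`. -/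
def transfer (t r q : R) : Cmd R := .seq (move r t) (move t q)

theorem runs_transfer {t r q : R} (htr : t ≠ r) (htq : t ≠ q) (hrq : r ≠ q) (ht : s t = []) :
    Runs (transfer t r q) s (Function.update (Function.update s r []) q (s r ++ s q))
      (6 * (s r).length + 2) := by
  refine ((runs_move htr.symm).seq (runs_move htq)).cast ?_ ?_
  · funext x
    simp only [Function.update_apply]
    split_ifs <;> simp_all
  · simp [ht]; omega

/-- Push a copy of the stack `r` to the stack `q`, by means of the empty stack `t`. -/
def copy (t r q : R) : Cmd R := .seq (move r t) (unload t r q)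

theorem runs_copy {t r q : R} (htr : t ≠ r) (htq : t ≠ q) (hrq : r ≠ q) (ht : s t = []) :
    Runs (copy t r q) s (Function.update s q (s r ++ s q)) (7 * (s r).length + 2) := by
  refine ((runs_move htr.symm).seq (runs_unload htr htq hrq _ _ rfl)).cast ?_ ?_
  · funext x
    simp only [Function.update_apply]
    split_ifs <;> simp_all
  · simp [ht]; omega

end Routines

end Cmd

/-! ### Binary numbers on stacks -/

/-- The binary digits of `n`, the least significant one first. -/
def digits (n : ℕ) : List Γ' := n.bits.map Γ'.bit

theorem digits_zero : digits 0 = [] := by simp [digits]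

theorem digits_one : digits 1 = [Γ'.bit true] := by simp [digits]

theorem digits_of_ne_zero {n : ℕ} (hn : n ≠ 0) :
    digits n = Γ'.bit (decide (n % 2 = 1)) :: digits (n / 2) := by
  conv_lhs => rw [digits, ← Nat.bit_bodd_div2 n]
  rw [Nat.bits_append_bit]
  · simp only [List.map_cons, digits, Nat.div2_val, List.cons.injEq, Γ'.bit.injEq, and_true]
    rw [Nat.mod_two_of_bodd]
    cases n.bodd <;> rfl
  · intro h
    rw [Nat.div2_val] at h
    have := Nat.mod_two_of_bodd n
    cases hb : n.bodd
    · rw [hb] at this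
      simp at this
      omega
    · rfl

theorem digits_tail (n : ℕ) : (digits n).tail = digits (n / 2) := by
  rcases eq_or_ne n 0 with rfl | hn
  · simp [digits_zero]
  · rw [digits_of_ne_zero hn, List.tail_cons]

theorem digits_two_mul {n : ℕ} (hn : n ≠ 0) : digits (2 * n) = Γ'.bit false :: digits n := by
  rw [digits_of_ne_zero (by omega)]
  simp

theorem digits_eq_nil {n : ℕ} : digits n = [] ↔ n = 0 := by
  refine ⟨fun h => ?_, fun h => h ▸ digits_zero⟩
  by_contra hn
  rw [digits_of_ne_zero hn] at h
  simp at h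

theorem digits_head?_eq_none {n : ℕ} : (digits n).head? = none ↔ n = 0 := by
  rw [List.head?_eq_none_iff, digits_eq_nil]

theorem truth_digits (n : ℕ) : Cmd.truth (digits n).head? = decide (n % 2 = 1) := by
  rcases eq_or_ne n 0 with rfl | hn
  · simp [digits_zero, Cmd.truth]
  · rw [digits_of_ne_zero hn]; rfl

theorem length_digits_le {n m : ℕ} (h : n < 2 ^ m) : (digits n).length ≤ m := by
  rw [digits, List.length_map, Nat.size_eq_bits_len]
  exact Nat.size_le.2 h

theorem lt_two_pow_length_digits (n : ℕ) : n < 2 ^ (digits n).length := by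
  rw [digits, List.length_map, Nat.size_eq_bits_len]
  exact Nat.lt_size_self n

/-- Links the encoding of instances to `Nat.bits`, for which division by two is removal of the first
digit. -/
theorem encodeNat_eq_bits (n : ℕ) : encodeNat n = n.bits := by
  have hp : ∀ p : PosNum, encodePosNum p = (p : ℕ).bits := by
    intro p
    induction p with
    | one => simp [encodePosNum]
    | bit0 p ih =>
      rw [encodePosNum, ih, PosNum.cast_bit0, ← two_mul, Nat.bit0_bits _ (PosNum.cast_pos p).ne']
    | bit1 p ih => rw [encodePosNum, ih, PosNum.cast_bit1, ← two_mul, Nat.bit1_bits]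
  have hn : ∀ m : Num, encodeNum m = (m : ℕ).bits := by
    intro m
    cases m with
    | zero => simp [encodeNum]
    | pos p => exact hp p
  rw [encodeNat, hn, Num.to_of_nat]

theorem map_encodeNat (n : ℕ) : (encodeNat n).map Γ'.bit = digits n := by
  rw [encodeNat_eq_bits, digits]

/-- The stacks of the program that evaluates the regret. -/
inductive Reg : Type
  | inp | sol | sol' | tmp | tmp' | carry | opX | opY | opZ | num | den
  | curP | curQ | bestP | bestQ | bndP | bndQ | aux
  deriving DecidableEq

instance : Fintype Reg where
  elems := {.inp, .sol, .sol', .tmp, .tmp', .carry, .opX, .opY, .opZ, .num, .den, .curP, .curQ,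
    .bestP, .bestQ, .bndP, .bndQ, .aux}
  complete r := by cases r <;> simp

/-- The content of the stacks between two arithmetic operations. -/
structure Data : Type where
  inp : List Γ' := []
  sol : List Γ' := []
  sol' : List Γ' := []
  opX : ℕ := 0
  opY : ℕ := 0
  opZ : ℕ := 0
  num : ℕ := 0
  den : ℕ := 0
  curP : ℕ := 0
  curQ : ℕ := 0
  bestP : ℕ := 0
  bestQ : ℕ := 0
  bndP : ℕ := 0
  bndQ : ℕ := 0
  aux : ℕ := 0

/-- The stacks that hold the given data. -/
def Data.stk (d : Data) : Reg → List Γ'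
  | .inp => d.inp
  | .sol => d.sol
  | .sol' => d.sol'
  | .tmp => []
  | .tmp' => []
  | .carry => []
  | .opX => digits d.opX
  | .opY => digits d.opY
  | .opZ => digits d.opZ
  | .num => digits d.num
  | .den => digits d.den
  | .curP => digits d.curP
  | .curQ => digits d.curQ
  | .bestP => digits d.bestP
  | .bestQ => digits d.bestQ
  | .bndP => digits d.bndP
  | .bndQ => digits d.bndQ
  | .aux => digits d.aux

namespace Cmd

open Reg

/-! ### Addition -/

/-- Add two digits and a carry. -/
def addDigits (c : Bool) (a b : Option Γ') : Cmd Reg :=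
  if a = none ∧ b = none then
    if c then .push tmp (Γ'.bit true) else .skip
  else
    .seq (pushSym tmp' b)
      (.seq (.push tmp (Γ'.bit (c ^^ (truth a ^^ truth b))))
        (.push carry (Γ'.bit (c && truth a || c && truth b || truth a && truth b))))

/-- Add the numbers on `opZ` and `opY` digit by digit; the digits of the sum and of the second
summand are collected in reverse order. -/
def addLoop : Cmd Reg :=
  .loop carry Option.isSome (.switch carry fun c => .switch opZ fun a => .switch opY fun b =>
    addDigits (truth c) a b)

/-- One column of schoolbook addition: the digit is the parity and the new carry the majority of
three bits. -/
theorem digits_half_sum {z y : ℕ} (c : Bool) (h : ¬(z = 0 ∧ y = 0)) :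
    digits (z + y + c.toNat) =
      Γ'.bit (c ^^ (decide (z % 2 = 1) ^^ decide (y % 2 = 1))) ::
        digits (z / 2 + y / 2 + (c && decide (z % 2 = 1) || c && decide (y % 2 = 1) ||
          decide (z % 2 = 1) && decide (y % 2 = 1)).toNat) := by
  have hs : z + y + c.toNat ≠ 0 := by omega
  rw [digits_of_ne_zero hs]
  rcases Nat.mod_two_eq_zero_or_one z with hz | hz <;>
    rcases Nat.mod_two_eq_zero_or_one y with hy | hy <;>
    cases c <;>
    simp only [hz, hy, Bool.toNat_false, Bool.toNat_true] <;>
    refine congr (congrArg _ (congrArg _ ?_)) (congrArg _ ?_) <;>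
    simp <;> omega

theorem pushSym_digits {R : Type} [DecidableEq R] (r : R) (y : ℕ) (s : R → List Γ') :
    Runs (pushSym r (digits y).head?) s
      (Function.update s r ((digits y).head?.toList ++ s r)) 1 := by
  cases h : (digits y).head? with
  | none => exact Runs.skip.cast (by simp) le_rfl
  | some g => exact (Runs.push r g).cast (by simp) le_rfl

theorem toList_head?_append_digits (y : ℕ) :
    (digits (y / 2)).reverse ++ (digits y).head?.toList = (digits y).reverse := by
  rcases eq_or_ne y 0 with rfl | hy
  · simp [digits_zero]
  · rw [digits_of_ne_zero hy]; simp

/-- A round costs seven steps. Once both numbers are exhausted, a last round of at most six steps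
writes the carry and leaves none behind, which ends the loop. The digits of `y` are saved on `tmp'`
because multiplication adds the same summand repeatedly. -/
theorem runs_addLoop (m : ℕ) : ∀ (z y : ℕ) (c : Bool) (s : Reg → List Γ'), z < 2 ^ m → y < 2 ^ m →
    s opZ = digits z → s opY = digits y → s carry = [Γ'.bit c] →
    Runs addLoop s (fun r => match r with
      | opZ => []
      | opY => []
      | carry => []
      | tmp => (digits (z + y + c.toNat)).reverse ++ s tmp
      | tmp' => (digits y).reverse ++ s tmp'
      | r => s r) (7 * m + 6) := by
  have hbase : ∀ (c : Bool) (s : Reg → List Γ'), s opZ = digits 0 → s opY = digits 0 →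
      s carry = [Γ'.bit c] → Runs addLoop s (fun r => match r with
      | opZ => []
      | opY => []
      | carry => []
      | tmp => (digits (0 + 0 + c.toNat)).reverse ++ s tmp
      | tmp' => (digits 0).reverse ++ s tmp'
      | r => s r) 6 := by
    intro c s hz hy hc
    rw [digits_zero] at hz hy
    unfold addLoop
    refine Runs.loop_step (s₁ := fun r => match r with
      | opZ => []
      | opY => []
      | carry => []
      | tmp => (digits (0 + 0 + c.toNat)).reverse ++ s tmp
      | tmp' => (digits 0).reverse ++ s tmp'
      | r => s r) (T₁ := 4) (T₂ := 1) (by simp [hc]) ?_ (Runs.loop_done rfl)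
    refine Runs.switch (Runs.switch (Runs.switch ?_))
    simp only [hc, hz, hy, Function.update_apply, reduceCtorEq, if_false, List.head?_nil,
      List.head?_cons, addDigits, and_self, if_true, truth]
    cases c
    · refine Runs.skip.cast ?_ le_rfl
      funext r
      cases r <;> simp [digits_zero, *]
    · refine (Runs.push _ _).cast ?_ le_rfl
      funext r
      cases r <;> simp [digits_zero, digits_one, *]
  induction m with
  | zero =>
    intro z y c s hz hy h₁ h₂ h₃
    obtain rfl : z = 0 := by omega
    obtain rfl : y = 0 := by omega
    exact hbase c s h₁ h₂ h₃
  | succ m ih =>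
    intro z y c s hz hy h₁ h₂ h₃
    by_cases h0 : z = 0 ∧ y = 0
    · obtain ⟨rfl, rfl⟩ := h0
      exact (hbase c s h₁ h₂ h₃).mono (by omega)
    rw [digits_half_sum c h0]
    set c' := (c && decide (z % 2 = 1) || c && decide (y % 2 = 1) ||
          decide (z % 2 = 1) && decide (y % 2 = 1)) with hc'
    set e := (c ^^ (decide (z % 2 = 1) ^^ decide (y % 2 = 1))) with he
    refine (Runs.loop_step (s₁ := fun r => match r with
      | opZ => digits (z / 2)
      | opY => digits (y / 2)
      | carry => [Γ'.bit c']
      | tmp => Γ'.bit e :: s tmp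
      | tmp' => (digits y).head?.toList ++ s tmp'
      | r => s r) (T₁ := 6) (by simp [h₃]) ?_
      (ih (z / 2) (y / 2) c' _ (by omega) (by omega) rfl rfl rfl)).cast ?_ (by omega)
    · refine Runs.switch (Runs.switch (Runs.switch ?_))
      simp only [h₁, h₂, h₃, Function.update_apply, reduceCtorEq, if_false, List.head?_cons,
        addDigits, digits_head?_eq_none, h0, truth_digits, List.tail_cons, digits_tail]
      rw [show truth (some (Γ'.bit c)) = c from rfl, ← hc', ← he]
      refine ((pushSym_digits _ _ _).seq ((Runs.push _ _).seq (Runs.push _ _))).cast ?_ le_rfl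
      funext r
      cases r <;> simp
    · funext r
      cases r <;> simp [← toList_head?_append_digits y]

/-- Add the number on `opY` to the number on `opZ`. -/
def add : Cmd Reg :=
  .seq (.push carry (Γ'.bit false)) (.seq addLoop (.seq (move tmp opZ) (move tmp' opY)))

theorem runs_add (d : Data) {m : ℕ} (hz : d.opZ < 2 ^ m) (hy : d.opY < 2 ^ m) :
    Runs add d.stk { d with opZ := d.opZ + d.opY : Data }.stk (13 * m + 12) := by
  have hs : d.opZ + d.opY < 2 ^ (m + 1) := by rw [pow_succ]; omega
  have l₁ := length_digits_le hs
  have l₂ := length_digits_le hy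
  refine ((Runs.push _ _).seq ((runs_addLoop m d.opZ d.opY false _ hz hy ?_ ?_ ?_).seq
    ((runs_move (by simp)).seq (runs_move (by simp))))).cast ?_ ?_
  · simp [Data.stk]
  · simp [Data.stk]
  · simp [Data.stk]
  · funext r
    cases r <;> simp [Data.stk, Function.update_apply]
  · simp [Data.stk, Function.update_apply]
    omega

/-! ### Multiplication -/

/-- Multiply the number on `opY` by two. -/
def double : Cmd Reg :=
  .switch opY fun o => match o with
    -- Zero is the empty stack; a zero digit pushed there would not be a canonical numeral.
    | none => .skip
    | some g => .seq (.push opY g) (.push opY (Γ'.bit false))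

theorem runs_double (d : Data) :
    Runs double d.stk { d with opY := 2 * d.opY : Data }.stk 3 := by
  refine Runs.switch ?_
  rcases eq_or_ne d.opY 0 with h | h
  · simp only [Data.stk, h, digits_zero, List.head?_nil]
    refine Runs.skip.cast ?_ (by omega)
    funext r
    cases r <;> simp [Data.stk, digits_zero]
  · simp only [Data.stk, digits_of_ne_zero h, List.head?_cons]
    refine ((Runs.push _ _).seq (Runs.push _ _)).cast ?_ le_rfl
    funext r
    cases r <;> simp [Data.stk, digits_two_mul h]
    exact (digits_of_ne_zero h).symm

/-- Process the digits of the factor on `opX`. -/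
def mulLoop : Cmd Reg :=
  .loop opX Option.isSome (.switch opX fun o => .seq (if truth o then add else .skip) double)

/-- Halving `opX`, doubling `opY` and adding `opY` for odd `opX` leaves `opZ + opX * opY` invariant.
While `opX` is nonzero, `opY` is at most the product, so one doubling stays below `2 ^ (w + 1)`. The
final `opY` is irrelevant, hence the existential. -/
theorem runs_mulLoop (w k : ℕ) : ∀ d : Data, d.opX < 2 ^ k → d.opY < 2 ^ (w + 1) →
    d.opZ + d.opX * d.opY < 2 ^ w → ∃ y < 2 ^ (w + 1),
    Runs mulLoop d.stk { d with opX := 0, opY := y, opZ := d.opZ + d.opX * d.opY : Data }.stk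
      (k * (13 * w + 17) + 1) := by
  have hbase : ∀ d : Data, d.opX = 0 →
      Runs mulLoop d.stk
        { d with opX := 0, opY := d.opY, opZ := d.opZ + d.opX * d.opY : Data }.stk 1 := by
    intro d h
    refine (Runs.loop_done (by simp [Data.stk, h, digits_zero])).cast ?_ le_rfl
    congr 1
    rw [h]
    cases d
    simp_all
  induction k with
  | zero =>
    intro d hx hy _
    exact ⟨d.opY, hy, (hbase d (by omega)).mono (by omega)⟩
  | succ k ih =>
    intro d hx hy hz
    by_cases h0 : d.opX = 0
    · exact ⟨d.opY, hy, (hbase d h0).mono (by omega)⟩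
    have hle : d.opY ≤ d.opX * d.opY := Nat.le_mul_of_pos_left _ (by omega)
    set b := d.opX % 2 with hb
    have hb2 : b < 2 := Nat.mod_lt _ (by omega)
    have hprod : d.opZ + b * d.opY + d.opX / 2 * (2 * d.opY) = d.opZ + d.opX * d.opY := by
      conv_rhs => rw [← Nat.div_add_mod d.opX 2, ← hb]
      ring
    obtain ⟨y, hy', h⟩ := ih { d with opX := d.opX / 2, opY := 2 * d.opY, opZ := d.opZ + b * d.opY }
      (show d.opX / 2 < _ by omega) (show 2 * d.opY < _ by rw [pow_succ]; omega)
      (show d.opZ + b * d.opY + d.opX / 2 * (2 * d.opY) < _ by rw [hprod]; exact hz)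
    refine ⟨y, hy', ?_⟩
    simp only [hprod] at h
    refine (Runs.loop_step (T₁ := 13 * w + 16) ?_ ?_ h).cast rfl (by ring_nf; omega)
    · simp [Data.stk, digits_of_ne_zero h0]
    · refine Runs.switch ?_
      simp only [Data.stk, digits_tail, truth_digits, ← hb]
      have e : Function.update d.stk opX (digits (d.opX / 2)) =
          { d with opX := d.opX / 2 : Data }.stk := by
        funext r
        cases r <;> simp [Data.stk]
      have e' : ∀ f : Reg → List Γ', f = d.stk → Function.update f opX (digits (d.opX / 2)) =
          { d with opX := d.opX / 2 : Data }.stk := fun f hf => hf ▸ e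
      have hadd : Runs (if decide (b = 1) = true then add else .skip)
          { d with opX := d.opX / 2 : Data }.stk
          { d with opX := d.opX / 2, opZ := d.opZ + b * d.opY : Data }.stk (13 * w + 12) := by
        rcases (by omega : b = 0 ∨ b = 1) with h | h <;> simp only [h]
        · exact Runs.skip.cast (by simp) (by omega)
        · exact (runs_add { d with opX := d.opX / 2 : Data } (m := w)
            (show d.opZ < _ by omega) (show d.opY < _ by omega)).cast (by simp) le_rfl
      rw [e' _ (by funext r; cases r <;> rfl)]
      exact (hadd.seq (runs_double _)).mono (by omega)

/-- Add the product of the numbers on `opX` and `opY` to the number on `opZ`. -/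
def mulAdd : Cmd Reg := .seq mulLoop (clear opY)

theorem runs_mulAdd (d : Data) {w : ℕ} (hx : d.opX < 2 ^ w) (hy : d.opY < 2 ^ w)
    (hz : d.opZ + d.opX * d.opY < 2 ^ w) :
    Runs mulAdd d.stk { d with opX := 0, opY := 0, opZ := d.opZ + d.opX * d.opY : Data }.stk
      (w * (13 * w + 20) + 5) := by
  obtain ⟨y, hy', h⟩ := runs_mulLoop w w d hx (by rw [pow_succ]; omega) hz
  refine (h.seq (runs_clear opY)).cast ?_ ?_
  · funext r
    cases r <;> simp [Data.stk, digits_zero]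
  · have := length_digits_le hy'
    simp only [Data.stk]
    nlinarith

/-! ### Comparison -/

/-- Compare two digits, where `c` is the result for the lower digits. -/
def lessDigits (c : Bool) (a b : Option Γ') : Cmd Reg :=
  if a = none ∧ b = none then .push tmp (Γ'.bit c)
  else .push carry (Γ'.bit (if truth a = truth b then c else truth b))

/-- Compare the numbers on `opX` and `opY` digit by digit. -/
def lessLoop : Cmd Reg :=
  .loop carry Option.isSome (.switch carry fun c => .switch opX fun a => .switch opY fun b =>
    lessDigits (truth c) a b)

/-- The least significant digits come first, so each later pair of distinct digits overrides the
verdict `c`, and equal digits keep it. -/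
theorem runs_lessLoop (m : ℕ) : ∀ (x y : ℕ) (c : Bool) (s : Reg → List Γ'), x < 2 ^ m → y < 2 ^ m →
    s opX = digits x → s opY = digits y → s carry = [Γ'.bit c] →
    Runs lessLoop s (fun r => match r with
      | opX => []
      | opY => []
      | carry => []
      | tmp => Γ'.bit (if x = y then c else decide (x < y)) :: s tmp
      | r => s r) (5 * m + 6) := by
  have hbase : ∀ (c : Bool) (s : Reg → List Γ'), s opX = digits 0 → s opY = digits 0 →
      s carry = [Γ'.bit c] → Runs lessLoop s (fun r => match r with
      | opX => []
      | opY => []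
      | carry => []
      | tmp => Γ'.bit (if 0 = 0 then c else decide (0 < 0)) :: s tmp
      | r => s r) 6 := by
    intro c s hx hy hc
    rw [digits_zero] at hx hy
    unfold lessLoop
    refine Runs.loop_step (s₁ := fun r => match r with
      | opX => []
      | opY => []
      | carry => []
      | tmp => Γ'.bit (if 0 = 0 then c else decide (0 < 0)) :: s tmp
      | r => s r) (T₁ := 4) (T₂ := 1) (by simp [hc]) ?_ (Runs.loop_done rfl)
    refine Runs.switch (Runs.switch (Runs.switch ?_))
    simp only [hc, hx, hy, Function.update_apply, reduceCtorEq, if_false, List.head?_nil,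
      List.head?_cons, lessDigits, and_self, if_true, truth]
    refine (Runs.push _ _).cast ?_ le_rfl
    funext r
    cases r <;> simp [*]
  induction m with
  | zero =>
    intro x y c s hx hy h₁ h₂ h₃
    obtain rfl : x = 0 := by omega
    obtain rfl : y = 0 := by omega
    exact hbase c s h₁ h₂ h₃
  | succ m ih =>
    intro x y c s hx hy h₁ h₂ h₃
    by_cases h0 : x = 0 ∧ y = 0
    · obtain ⟨rfl, rfl⟩ := h0
      exact (hbase c s h₁ h₂ h₃).mono (by omega)
    set c' := if decide (x % 2 = 1) = decide (y % 2 = 1) then c else decide (y % 2 = 1) with hc'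
    have hless : (if x / 2 = y / 2 then c' else decide (x / 2 < y / 2)) =
        if x = y then c else decide (x < y) := by
      rcases Nat.mod_two_eq_zero_or_one x with hx | hx <;>
        rcases Nat.mod_two_eq_zero_or_one y with hy | hy <;>
        simp only [hc', hx, hy] <;> split_ifs <;> first | omega | rfl | skip
      all_goals simp_all
      all_goals omega
    rw [← hless]
    refine (Runs.loop_step (s₁ := fun r => match r with
      | opX => digits (x / 2)
      | opY => digits (y / 2)
      | carry => [Γ'.bit c']
      | r => s r) (T₁ := 4) (by simp [h₃]) ?_
      (ih (x / 2) (y / 2) c' _ (by omega) (by omega) rfl rfl rfl)).cast ?_ (by omega)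
    · refine Runs.switch (Runs.switch (Runs.switch ?_))
      simp only [h₁, h₂, h₃, Function.update_apply, reduceCtorEq, if_false, List.head?_cons,
        lessDigits, digits_head?_eq_none, h0, truth_digits, List.tail_cons, digits_tail]
      rw [show truth (some (Γ'.bit c)) = c from rfl, ← hc']
      refine (Runs.push _ _).cast ?_ le_rfl
      funext r
      cases r <;> simp
    · funext r
      cases r <;> rfl

/-- Branch on the comparison of the numbers on `opX` and `opY`. -/
def ifLess (a b : Cmd Reg) : Cmd Reg :=
  .seq (.push carry (Γ'.bit false)) (.seq lessLoop (.switch tmp fun o => cond (truth o) a b))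

theorem runs_ifLess (d : Data) {a b : Cmd Reg} {m T : ℕ} {s : Reg → List Γ'}
    (hx : d.opX < 2 ^ m) (hy : d.opY < 2 ^ m)
    (h : Runs (if d.opX < d.opY then a else b) { d with opX := 0, opY := 0 : Data }.stk s T) :
    Runs (ifLess a b) d.stk s (5 * m + 8 + T) := by
  refine ((Runs.push _ _).seq ((runs_lessLoop m d.opX d.opY false _ hx hy ?_ ?_ ?_).seq
    (Runs.switch (T := T) ?_))).mono (by omega)
  · simp [Data.stk]
  · simp [Data.stk]
  · simp [Data.stk]
  · simp only [List.head?_cons, truth, List.tail_cons]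
    have e : cond (if d.opX = d.opY then false else decide (d.opX < d.opY)) a b =
        if d.opX < d.opY then a else b := by
      by_cases h : d.opX = d.opY <;> simp [h]
    rw [e]
    convert h using 1
    funext r
    cases r <;> simp [Data.stk, digits_zero, Function.update_apply]

end Cmd

/-! ### Number stacks addressed by name -/

/-- The stacks that hold numbers. -/
def Reg.isNum : Reg → Bool
  | .inp | .sol | .sol' | .tmp | .tmp' | .carry => false
  | _ => true

/-- The number on a stack. -/
def Data.get (d : Data) : Reg → ℕ
  | .opX => d.opX
  | .opY => d.opY
  | .opZ => d.opZ
  | .num => d.num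
  | .den => d.den
  | .curP => d.curP
  | .curQ => d.curQ
  | .bestP => d.bestP
  | .bestQ => d.bestQ
  | .bndP => d.bndP
  | .bndQ => d.bndQ
  | .aux => d.aux
  | _ => 0

/-- Replace the number on a stack. -/
def Data.set (d : Data) (r : Reg) (n : ℕ) : Data :=
  match r with
  | .opX => { d with opX := n }
  | .opY => { d with opY := n }
  | .opZ => { d with opZ := n }
  | .num => { d with num := n }
  | .den => { d with den := n }
  | .curP => { d with curP := n }
  | .curQ => { d with curQ := n }
  | .bestP => { d with bestP := n }
  | .bestQ => { d with bestQ := n }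
  | .bndP => { d with bndP := n }
  | .bndQ => { d with bndQ := n }
  | .aux => { d with aux := n }
  | _ => d

theorem Data.stk_eq_digits (d : Data) {r : Reg} (hr : r.isNum = true) :
    d.stk r = digits (d.get r) := by
  cases r <;> first | rfl | exact absurd hr (by decide)

theorem Data.stk_set (d : Data) {r : Reg} (hr : r.isNum = true) (n : ℕ) :
    (d.set r n).stk = Function.update d.stk r (digits n) := by
  funext x
  cases r <;> first | exact absurd hr (by decide) | (cases x <;> simp [Data.stk, Data.set])

theorem Data.get_set (d : Data) {r : Reg} (hr : r.isNum = true) (x : Reg) (n : ℕ) :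
    (d.set r n).get x = if x = r then n else d.get x := by
  cases r <;> first | exact absurd hr (by decide) | (cases x <;> simp [Data.get, Data.set])

theorem Reg.ne_tmp {r : Reg} (hr : r.isNum = true) : r ≠ .tmp := by
  rintro rfl
  cases hr

namespace Cmd

open Reg

variable {d : Data} {r q : Reg} {w : ℕ}

theorem runs_clear_num (hr : r.isNum = true) (h : d.get r < 2 ^ w) :
    Runs (clear r) d.stk (d.set r 0).stk (3 * w + 1) := by
  refine (runs_clear r).cast ?_ ?_
  · rw [d.stk_set hr, digits_zero]
  · have := length_digits_le h
    rw [d.stk_eq_digits hr]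
    omega

theorem runs_transfer_num (hr : r.isNum = true) (hq : q.isNum = true) (hrq : r ≠ q)
    (h0 : d.get q = 0) (h : d.get r < 2 ^ w) :
    Runs (transfer tmp r q) d.stk ((d.set r 0).set q (d.get r)).stk (6 * w + 2) := by
  refine (runs_transfer (Reg.ne_tmp hr).symm (Reg.ne_tmp hq).symm hrq rfl).cast ?_ ?_
  · rw [Data.stk_set _ hq, Data.stk_set _ hr, d.stk_eq_digits hr, d.stk_eq_digits hq, h0,
      digits_zero, List.append_nil]
  · have := length_digits_le h
    rw [d.stk_eq_digits hr]
    omega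

theorem runs_copy_num (hr : r.isNum = true) (hq : q.isNum = true) (hrq : r ≠ q)
    (h0 : d.get q = 0) (h : d.get r < 2 ^ w) :
    Runs (copy tmp r q) d.stk (d.set q (d.get r)).stk (7 * w + 2) := by
  refine (runs_copy (Reg.ne_tmp hr).symm (Reg.ne_tmp hq).symm hrq rfl).cast ?_ ?_
  · rw [Data.stk_set _ hq, d.stk_eq_digits hr, d.stk_eq_digits hq, h0, digits_zero,
      List.append_nil]
  · have := length_digits_le h
    rw [d.stk_eq_digits hr]
    omega

/-- Add the product of the numbers on `r` and `q` to the number on `opZ`. -/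
def prodAdd (r q : Reg) : Cmd Reg := .seq (copy tmp r opX) (.seq (copy tmp q opY) mulAdd)

/-- Both factors survive, since only copies are multiplied; `hqX` keeps the second factor intact
while `opX` is filled. -/
theorem runs_prodAdd (r q : Reg) (hr : r.isNum = true) (hq : q.isNum = true) (hrX : r ≠ opX)
    (hqX : q ≠ opX) (hqY : q ≠ opY) (hX : d.opX = 0) (hY : d.opY = 0)
    (h₁ : d.get r < 2 ^ w) (h₂ : d.get q < 2 ^ w) (h₃ : d.opZ + d.get r * d.get q < 2 ^ w) :
    Runs (prodAdd r q) d.stk { d with opZ := d.opZ + d.get r * d.get q : Data }.stk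
      (34 * (w + 1) ^ 2) := by
  have hg : (d.set opX (d.get r)).get q = d.get q := by rw [Data.get_set _ rfl, if_neg hqX]
  refine ((runs_copy_num hr (q := opX) rfl hrX hX h₁).seq
    ((runs_copy_num (d := d.set opX (d.get r)) hq (q := opY) rfl hqY hY (by rwa [hg])).seq
      (runs_mulAdd _ (w := w) ?_ ?_ ?_))).cast ?_ ?_
  · exact h₁
  · exact hg ▸ h₂
  · rw [hg]
    exact h₃
  · rw [hg]
    cases d
    simp_all [Data.set]
  · nlinarith

/-- Move the number on `opZ` to `r`. -/
def assign (r : Reg) : Cmd Reg := .seq (clear r) (transfer tmp opZ r)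

theorem runs_assign (r : Reg) (hr : r.isNum = true) (hrZ : r ≠ opZ) (h₁ : d.get r < 2 ^ w)
    (h₂ : d.opZ < 2 ^ w) :
    Runs (assign r) d.stk { d.set r d.opZ with opZ := 0 : Data }.stk (9 * (w + 1) ^ 2) := by
  have hZ : (d.set r 0).get opZ = d.opZ := by rw [Data.get_set _ hr, if_neg hrZ.symm]; rfl
  refine ((runs_clear_num hr h₁).seq (runs_transfer_num (r := opZ) rfl hr hrZ.symm
    (by rw [Data.get_set _ hr, if_pos rfl]) (hZ.symm ▸ h₂))).cast ?_ ?_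
  · rw [hZ]
    cases r <;> first | exact absurd rfl hrZ | exact absurd hr (by decide) | rfl
  · nlinarith

/-! ### Reading numbers -/

/-- Is the symbol a binary digit? -/
def isBit : Option Γ' → Bool
  | some (.bit _) => true
  | _ => false

/-- Is the symbol an opening bracket? -/
def isBra : Option Γ' → Bool
  | some .bra => true
  | _ => false

theorem isBit_of_mem_map {l : List Bool} {g : Γ'} (h : g ∈ l.map Γ'.bit) :
    isBit (some g) = true := by
  obtain ⟨b, _, rfl⟩ := List.mem_map.1 h
  rfl

/-- Read the digits on top of the input, up to a delimiter. -/
def readDigits (r : Reg) : Cmd Reg :=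
  .seq (.seq (moveWhile isBit inp tmp) (move tmp r)) (drop inp)

/-- Two reversals through `tmp` preserve the order of the digits. -/
theorem runs_readDigits (hr : r.isNum = true) (h0 : d.get r = 0) (n : ℕ) (g : Γ')
    (hg : isBit (some g) = false) (l : List Γ') (hd : d.inp = digits n ++ g :: l) :
    Runs (readDigits r) d.stk ({ d with inp := l : Data }.set r n).stk
      (6 * (digits n).length + 4) := by
  have hi : inp ≠ r := by
    rintro rfl
    cases hr
  refine (((runs_moveWhile (r := inp) (q := tmp) (by simp) (digits n) (g :: l) (fun _ => isBit_of_mem_map) hg d.stk hd).seq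
    (runs_move (Reg.ne_tmp hr).symm)).seq (runs_drop _)).cast ?_ ?_
  · have hs : d.stk r = [] := by rw [d.stk_eq_digits hr, h0, digits_zero]
    rw [Data.stk_set _ hr]
    funext x
    by_cases hx : x = r
    · subst hx
      simp only [Function.update_apply, hi.symm, Reg.ne_tmp hr, if_true, if_false, hs]
      simp [Data.stk]
    · cases x <;> simp_all [Function.update_apply, Data.stk]
  · simp [Data.stk]
    omega

/-- Remove the digits on top of the input and the delimiter that follows. -/
def skipDigits : Cmd Reg := .seq (dropWhile isBit inp) (drop inp)

theorem runs_skipDigits (n : ℕ) (g : Γ')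
    (hg : isBit (some g) = false) (l : List Γ') (hd : d.inp = digits n ++ g :: l) :
    Runs skipDigits d.stk { d with inp := l : Data }.stk (3 * (digits n).length + 3) := by
  refine ((runs_dropWhile (r := inp) (digits n) (g :: l) (fun _ => isBit_of_mem_map) hg d.stk hd).seq
    (runs_drop _)).cast ?_ (by omega)
  funext x
  cases x <;> simp [Data.stk]

/-- Read a fraction without its sign; if `take` is false, the numerator is replaced by zero. -/
def readFraction (take : Bool) (r q : Reg) : Cmd Reg :=
  .seq (if take then readDigits r else skipDigits) (readDigits q)

theorem runs_readFraction (take : Bool) (hr : r.isNum = true) (hq : q.isNum = true) (hrq : q ≠ r)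
    (hr0 : d.get r = 0) (hq0 : d.get q = 0) (a b : ℕ) (l : List Γ')
    (hd : d.inp = digits a ++ Γ'.comma :: (digits b ++ Γ'.ket :: l)) :
    Runs (readFraction take r q) d.stk
      (({ d with inp := l : Data }.set r (if take then a else 0)).set q b).stk
      (6 * ((digits a).length + (digits b).length) + 8) := by
  have h₁ : Runs (if take then readDigits r else skipDigits) d.stk
      ({ d with inp := digits b ++ Γ'.ket :: l : Data }.set r (if take then a else 0)).stk
      (6 * (digits a).length + 4) := by
    cases take
    · refine (runs_skipDigits a .comma rfl _ hd).cast ?_ (by omega)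
      rw [if_neg Bool.false_ne_true, Data.stk_set _ hr, digits_zero]
      funext x
      by_cases hx : x = r
      · subst hx
        rw [Function.update_self, Data.stk_eq_digits _ hr, ← digits_zero, ← hr0]
        cases x <;> rfl
      · rw [Function.update_of_ne hx]
    · exact runs_readDigits hr hr0 a .comma rfl _ hd
  refine (h₁.seq (runs_readDigits (d := { d with inp := digits b ++ Γ'.ket :: l : Data }.set r _)
    hq ?_ b .ket rfl l ?_)).cast ?_ (by omega)
  · rw [Data.get_set _ hr, if_neg hrq, ← hq0]
    cases q <;> rfl
  · cases r <;> rfl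
  · cases r <;> rfl

end Cmd

/-! ### The algorithm on pairs of natural numbers -/

/-- The numerator of `max 0 c` or `max 0 (-c)`, depending on the bit. -/
def takenNum (b : Bool × ℚ) : ℕ := if b.1 ^^ decide (b.2.num < 0) then b.2.num.natAbs else 0

/-- Add a contribution of one item to a fraction. -/
def itemStep (v : ℕ × ℕ) (b : Bool × ℚ) : ℕ × ℕ :=
  (v.1 * b.2.den + takenNum b * v.2, v.2 * b.2.den)

/-- The larger one of two fractions. -/
def betterOf (v w : ℕ × ℕ) : ℕ × ℕ := if v.1 * w.2 < w.1 * v.2 then w else v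

/-- The regret of a solution for one scenario as a fraction. -/
def scenarioValue (xs : List Bool) (cs : List ℚ) : ℕ × ℕ :=
  (xs.zip cs).foldl itemStep (0, 1)

/-- The regret of a solution as a fraction. -/
def regretFraction (xs : List Bool) (css : List (List ℚ)) : ℕ × ℕ :=
  (css.map (scenarioValue xs)).foldl betterOf (0, 1)

theorem encodeRat_eq (c : ℚ) (l : List Γ') : encodeRat c ++ l =
    Γ'.bra :: Γ'.bit (decide (c.num < 0)) ::
      (digits c.num.natAbs ++ Γ'.comma :: (digits c.den ++ Γ'.ket :: l)) := by
  simp [encodeRat, encodeFraction, map_encodeNat]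

theorem length_encodeRat (c : ℚ) :
    (encodeRat c).length = (digits c.num.natAbs).length + (digits c.den).length + 4 := by
  have := congrArg List.length (encodeRat_eq c [])
  simp at this
  omega

namespace Cmd

open Reg

/-! ### The program -/

/-- Add the fraction on `num` and `den` to the one on `curP` and `curQ`. -/
def addFraction : Cmd Reg :=
  .seq (.seq (prodAdd curP den) (.seq (prodAdd num curQ) (assign curP)))
    (.seq (.seq (prodAdd curQ den) (assign curQ)) (.seq (clear num) (clear den)))

/-- The numerator is formed before the denominator because it needs the old `curQ`. -/
theorem runs_addFraction (d : Data) {w : ℕ} (hX : d.opX = 0) (hY : d.opY = 0) (hZ : d.opZ = 0)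
    (h₁ : d.curP < 2 ^ w) (h₂ : d.curQ < 2 ^ w) (h₃ : d.num < 2 ^ w) (h₄ : d.den < 2 ^ w)
    (h₅ : d.curP * d.den + d.num * d.curQ < 2 ^ w) (h₆ : d.curQ * d.den < 2 ^ w) :
    Runs addFraction d.stk
      { d with
        curP := d.curP * d.den + d.num * d.curQ
        curQ := d.curQ * d.den
        num := 0
        den := 0 : Data }.stk (126 * (w + 1) ^ 2) := by
  obtain ⟨inp₀, sol₀, sol₀', opX₀, opY₀, opZ₀, num₀, den₀, curP₀, curQ₀, bestP₀, bestQ₀, bndP₀,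
    bndQ₀, aux₀⟩ := d
  simp only at hX hY hZ h₁ h₂ h₃ h₄ h₅ h₆
  subst hX hY hZ
  have r₁ := runs_prodAdd (w := w) (d := ⟨inp₀, sol₀, sol₀', 0, 0, 0, num₀, den₀, curP₀, curQ₀,
    bestP₀, bestQ₀, bndP₀, bndQ₀, aux₀⟩) curP den rfl rfl (by simp) (by simp) (by simp) rfl rfl h₁ h₄
    (show 0 + curP₀ * den₀ < _ by omega)
  have r₂ := runs_prodAdd (w := w) (d := ⟨inp₀, sol₀, sol₀', 0, 0, 0 + curP₀ * den₀, num₀, den₀,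
    curP₀, curQ₀, bestP₀, bestQ₀, bndP₀, bndQ₀, aux₀⟩) num curQ rfl rfl (by simp) (by simp)
    (by simp) rfl rfl h₃ h₂ (show 0 + curP₀ * den₀ + num₀ * curQ₀ < _ by omega)
  have r₃ := runs_assign (w := w) (d := ⟨inp₀, sol₀, sol₀', 0, 0,
    0 + curP₀ * den₀ + num₀ * curQ₀, num₀, den₀,
    curP₀, curQ₀, bestP₀, bestQ₀, bndP₀, bndQ₀, aux₀⟩) curP rfl (by simp) h₁
    (show 0 + curP₀ * den₀ + num₀ * curQ₀ < _ by omega)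
  have r₄ := runs_prodAdd (w := w) (d := ⟨inp₀, sol₀, sol₀', 0, 0, 0, num₀, den₀,
    0 + curP₀ * den₀ + num₀ * curQ₀, curQ₀,
    bestP₀, bestQ₀, bndP₀, bndQ₀, aux₀⟩) curQ den rfl rfl (by simp) (by simp) (by simp) rfl rfl h₂ h₄
    (show 0 + curQ₀ * den₀ < _ by omega)
  have r₅ := runs_assign (w := w) (d := ⟨inp₀, sol₀, sol₀', 0, 0, 0 + curQ₀ * den₀, num₀, den₀,
    0 + curP₀ * den₀ + num₀ * curQ₀, curQ₀, bestP₀, bestQ₀, bndP₀, bndQ₀, aux₀⟩) curQ rfl (by simp)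
    h₂ (show 0 + curQ₀ * den₀ < _ by omega)
  have r₆ := runs_clear_num (w := w) (r := num) (d := ⟨inp₀, sol₀, sol₀', 0, 0, 0, num₀, den₀,
    0 + curP₀ * den₀ + num₀ * curQ₀, 0 + curQ₀ * den₀, bestP₀, bestQ₀, bndP₀, bndQ₀, aux₀⟩) rfl h₃
  have r₇ := runs_clear_num (w := w) (r := den) (d := ⟨inp₀, sol₀, sol₀', 0, 0, 0, 0, den₀,
    0 + curP₀ * den₀ + num₀ * curQ₀, 0 + curQ₀ * den₀, bestP₀, bestQ₀, bndP₀, bndQ₀, aux₀⟩) rfl h₄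
  refine ((r₁.seq (r₂.seq r₃)).seq ((r₄.seq r₅).seq (r₆.seq r₇))).cast ?_ (by nlinarith)
  simp [Data.set]

/-- Read a cost coefficient and add its contribution. -/
def item : Cmd Reg :=
  .seq (drop inp) (.seq (.switch inp fun s => .switch sol fun x => .seq (pushSym sol' x)
    (readFraction (truth x ^^ truth s) num den)) addFraction)

/-- The size estimate behind polynomial time: a fraction with `ℓ`-bit entries gains at most as many
bits as the new coefficient has symbols. -/
theorem runs_item (d : Data) {w ℓ : ℕ} (b : Bool × ℚ) (l l' : List Γ')
    (hi : d.inp = encodeRat b.2 ++ l) (hs : d.sol = Γ'.bit b.1 :: l')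
    (hX : d.opX = 0) (hY : d.opY = 0) (hZ : d.opZ = 0) (hn : d.num = 0) (hd : d.den = 0)
    (h₁ : d.curP < 2 ^ ℓ) (h₂ : d.curQ < 2 ^ ℓ) (hw : ℓ + (encodeRat b.2).length ≤ w) :
    (itemStep (d.curP, d.curQ) b).1 < 2 ^ (ℓ + (encodeRat b.2).length) ∧
    (itemStep (d.curP, d.curQ) b).2 < 2 ^ (ℓ + (encodeRat b.2).length) ∧
    Runs item d.stk
      { d with
        inp := l
        sol := l'
        sol' := Γ'.bit b.1 :: d.sol'
        curP := (itemStep (d.curP, d.curQ) b).1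
        curQ := (itemStep (d.curP, d.curQ) b).2 : Data }.stk (150 * (w + 1) ^ 2) := by
  rw [length_encodeRat] at hw ⊢
  set la := (digits b.2.num.natAbs).length
  set lb := (digits b.2.den).length
  have ha : takenNum b < 2 ^ la := by
    have := lt_two_pow_length_digits b.2.num.natAbs
    unfold takenNum
    split_ifs
    · exact this
    · positivity
  have hb : b.2.den < 2 ^ lb := lt_two_pow_length_digits b.2.den
  have hw₁ : 2 ^ (ℓ + (la + lb + 4)) ≤ 2 ^ w := Nat.pow_le_pow_right (by norm_num) hw
  -- The sign and the three delimiters of an encoded rational contribute the factor 16, more than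
  -- enough for the sum of two products.
  have hp : 2 ^ (ℓ + (la + lb + 4)) = 2 ^ ℓ * 2 ^ la * 2 ^ lb * 16 := by
    rw [pow_add, pow_add, pow_add]; ring
  have e₁ : d.curP * b.2.den ≤ 2 ^ ℓ * 2 ^ lb := Nat.mul_le_mul h₁.le hb.le
  have e₂ : takenNum b * d.curQ ≤ 2 ^ la * 2 ^ ℓ := Nat.mul_le_mul ha.le h₂.le
  have e₃ : d.curQ * b.2.den ≤ 2 ^ ℓ * 2 ^ lb := Nat.mul_le_mul h₂.le hb.le
  have pℓ : 1 ≤ 2 ^ ℓ := Nat.one_le_two_pow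
  have pa : 1 ≤ 2 ^ la := Nat.one_le_two_pow
  have pb : 1 ≤ 2 ^ lb := Nat.one_le_two_pow
  have f₁ : 2 ^ ℓ * 2 ^ lb ≤ 2 ^ ℓ * 2 ^ la * 2 ^ lb := by
    nlinarith [Nat.mul_le_mul (Nat.mul_le_mul (le_refl (2 ^ ℓ)) pa) (le_refl (2 ^ lb))]
  have f₂ : 2 ^ la * 2 ^ ℓ ≤ 2 ^ ℓ * 2 ^ la * 2 ^ lb := by
    nlinarith [Nat.mul_le_mul (le_refl (2 ^ ℓ * 2 ^ la)) pb]
  have f₃ : 1 ≤ 2 ^ ℓ * 2 ^ la * 2 ^ lb := Nat.one_le_iff_ne_zero.2 (by positivity)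
  have g₁ : d.curP * b.2.den + takenNum b * d.curQ < 2 ^ (ℓ + (la + lb + 4)) := by omega
  have g₂ : d.curQ * b.2.den < 2 ^ (ℓ + (la + lb + 4)) := by omega
  refine ⟨g₁, g₂, ?_⟩
  have pw : ∀ {x k : ℕ}, x < 2 ^ k → k ≤ w → x < 2 ^ w := fun h h' =>
    h.trans_le (Nat.pow_le_pow_right (by norm_num) h')
  rw [encodeRat_eq] at hi
  have r₁ := runs_drop (s := d.stk) inp
  have r₂ : Runs (.switch inp fun s => .switch sol fun x => .seq (pushSym sol' x)
      (readFraction (truth x ^^ truth s) num den)) (Function.update d.stk inp (d.stk inp).tail)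
      { d with
        inp := l
        sol := l'
        sol' := Γ'.bit b.1 :: d.sol'
        num := takenNum b
        den := b.2.den : Data }.stk (6 * (la + lb) + 11) := by
    refine Runs.switch (Runs.switch ?_)
    simp only [Data.stk, hi, hs, Function.update_apply, reduceCtorEq, if_false, if_true,
      List.tail_cons, List.head?_cons, truth, pushSym]
    have r := runs_readFraction (r := num) (q := den)
      (d := { d with inp := digits b.2.num.natAbs ++ Γ'.comma :: (digits b.2.den ++ Γ'.ket :: l)
                     sol := l'
                     sol' := Γ'.bit b.1 :: d.sol' : Data })
      (b.1 ^^ decide (b.2.num < 0)) rfl rfl (by simp) hn hd b.2.num.natAbs b.2.den l rfl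
    refine ((Runs.push _ _).seq (Runs.cast (s := _) ?_ rfl le_rfl)).cast rfl
      (T₁ := 1 + (6 * (la + lb) + 8)) (by omega)
    convert r using 1
    · funext x
      cases x <;> simp [Data.stk]
    · rfl
  have r₃ := runs_addFraction (w := w)
    { d with
      inp := l
      sol := l'
      sol' := Γ'.bit b.1 :: d.sol'
      num := takenNum b
      den := b.2.den : Data } hX hY hZ (pw h₁ (by omega)) (pw h₂ (by omega)) (pw ha (by omega))
      (pw hb (by omega)) (g₁.trans_le hw₁) (g₂.trans_le hw₁)
  refine (r₁.seq (r₂.seq r₃)).cast ?_ (by nlinarith)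
  simp [itemStep, hn, hd]

/-- The numbers of an instance that are not modified by the evaluation of a scenario, and the
empty stacks. -/
def base (i s s' : List Γ') (v w β : ℕ × ℕ) : Data where
  inp := i
  sol := s
  sol' := s'
  curP := v.1
  curQ := v.2
  bestP := w.1
  bestQ := w.2
  bndP := β.1
  bndQ := β.2

/-- The budget `ℓ` plus the length of the unread coefficients is constant along the induction. -/
theorem runs_items (w : ℕ) (v' β : ℕ × ℕ) (l : List Γ') (bs : List (Bool × ℚ)) :
    ∀ (ℓ : ℕ) (v : ℕ × ℕ) (s s' : List Γ'), v.1 < 2 ^ ℓ → v.2 < 2 ^ ℓ →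
    ℓ + (bs.map fun b => encodeRat b.2).flatten.length ≤ w →
    (bs.foldl itemStep v).1 < 2 ^ w ∧ (bs.foldl itemStep v).2 < 2 ^ w ∧
    Runs (.loop inp isBra item)
      (base ((bs.map fun b => encodeRat b.2).flatten ++ Γ'.ket :: l)
        ((bs.map fun b => Γ'.bit b.1) ++ s) s' v v' β).stk
      (base (Γ'.ket :: l) s ((bs.map fun b => Γ'.bit b.1).reverse ++ s')
        (bs.foldl itemStep v) v' β).stk (bs.length * (151 * (w + 1) ^ 2) + 1) := by
  induction bs with
  | nil =>
    intro ℓ v s s' h₁ h₂ hw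
    have pw : ∀ {x k : ℕ}, x < 2 ^ k → k ≤ w → x < 2 ^ w := fun h h' =>
      h.trans_le (Nat.pow_le_pow_right (by norm_num) h')
    simp only [List.map_nil, List.flatten_nil, List.length_nil, List.foldl_nil,
      List.nil_append, List.reverse_nil] at hw ⊢
    exact ⟨pw h₁ (by omega), pw h₂ (by omega), (Runs.loop_done rfl).mono (by omega)⟩
  | cons b bs ih =>
    intro ℓ v s s' h₁ h₂ hw
    simp only [List.map_cons, List.flatten_cons, List.length_append] at hw
    obtain ⟨g₁, g₂, r⟩ := runs_item (w := w) (ℓ := ℓ)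
      (base (((b :: bs).map fun b => encodeRat b.2).flatten ++ Γ'.ket :: l)
        (((b :: bs).map fun b => Γ'.bit b.1) ++ s) s' v v' β) b
        ((bs.map fun b => encodeRat b.2).flatten ++ Γ'.ket :: l)
        ((bs.map fun b => Γ'.bit b.1) ++ s) (by simp [base]) (by simp [base]) rfl rfl rfl rfl rfl
        h₁ h₂ (by omega)
    obtain ⟨k₁, k₂, r'⟩ := ih (ℓ + (encodeRat b.2).length) (itemStep v b) s (Γ'.bit b.1 :: s')
      g₁ g₂ (by omega)
    refine ⟨k₁, k₂, (Runs.loop_step ?_ r r').cast ?_ ?_⟩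
    · simp [base, Data.stk, encodeRat_eq, isBra]
    · simp
    · simp only [List.length_cons]
      nlinarith

/-- Replace the best fraction by the current one. -/
def replace : Cmd Reg :=
  .seq (.seq (clear bestP) (clear bestQ)) (.seq (transfer tmp curP bestP) (transfer tmp curQ bestQ))

/-- Replace the best fraction by the current one if that one is larger, and reset the
current one. -/
def improve : Cmd Reg :=
  .seq (.seq (.seq (prodAdd bestP curQ) (transfer tmp opZ aux))
      (.seq (prodAdd curP bestQ) (.seq (transfer tmp opZ opY) (transfer tmp aux opX))))
    (.seq (ifLess replace .skip) (.seq (clear curP) (.seq (clear curQ)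
      (.push curQ (Γ'.bit true)))))

theorem runs_replace (w : ℕ) (i s s' : List Γ') (v v' β : ℕ × ℕ) (h₁ : v.1 < 2 ^ w)
    (h₂ : v.2 < 2 ^ w) (h₃ : v'.1 < 2 ^ w) (h₄ : v'.2 < 2 ^ w) :
    Runs replace (base i s s' v v' β).stk (base i s s' (0, 0) v β).stk (18 * w + 6) := by
  have r₁ := runs_clear_num (d := base i s s' v v' β) (r := bestP) (w := w) rfl h₃
  have r₂ := runs_clear_num (d := base i s s' v (0, v'.2) β) (r := bestQ) (w := w) rfl h₄
  have r₃ := runs_transfer_num (d := base i s s' v (0, 0) β) (r := curP) (q := bestP) (w := w)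
    rfl rfl (by simp) rfl h₁
  have r₄ := runs_transfer_num (d := base i s s' (0, v.2) (v.1, 0) β) (r := curQ) (q := bestQ)
    (w := w) rfl rfl (by simp) rfl h₂
  exact ((r₁.seq r₂).seq (r₃.seq r₄)).mono (by omega)

theorem runs_improve {w : ℕ} (i s s' : List Γ') (v v' β : ℕ × ℕ) (h₁ : v.1 < 2 ^ w)
    (h₂ : v.2 < 2 ^ w) (h₃ : v'.1 < 2 ^ w) (h₄ : v'.2 < 2 ^ w) (h₅ : v'.1 * v.2 < 2 ^ w)
    (h₆ : v.1 * v'.2 < 2 ^ w) :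
    Runs improve (base i s s' v v' β).stk (base i s s' (0, 1) (betterOf v' v) β).stk
      (120 * (w + 1) ^ 2) := by
  have r₁ := runs_prodAdd (w := w) (d := base i s s' v v' β) bestP curQ rfl rfl (by simp)
    (by simp) (by simp) rfl rfl h₃ h₂ (show 0 + v'.1 * v.2 < _ by omega)
  -- The first product waits on `aux`, because the next multiplication needs `opX`, `opY` and `opZ`
  -- empty.
  have r₂ := runs_transfer_num (w := w) (d := { base i s s' v v' β with opZ := 0 + v'.1 * v.2 })
    (r := opZ) (q := aux) rfl rfl (by simp) rfl (show 0 + v'.1 * v.2 < _ by omega)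
  have r₃ := runs_prodAdd (w := w) (d := { base i s s' v v' β with aux := 0 + v'.1 * v.2 })
    curP bestQ rfl rfl (by simp) (by simp) (by simp) rfl rfl h₁ h₄
    (show 0 + v.1 * v'.2 < _ by omega)
  have r₄ := runs_transfer_num (w := w)
    (d := { base i s s' v v' β with aux := 0 + v'.1 * v.2, opZ := 0 + v.1 * v'.2 })
    (r := opZ) (q := opY) rfl rfl (by simp) rfl (show 0 + v.1 * v'.2 < _ by omega)
  have r₅ := runs_transfer_num (w := w)
    (d := { base i s s' v v' β with aux := 0 + v'.1 * v.2, opY := 0 + v.1 * v'.2 })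
    (r := aux) (q := opX) rfl rfl (by simp) rfl (show 0 + v'.1 * v.2 < _ by omega)
  -- The branches leave different current fractions, `(0, 0)` or `v`; `u` stands for either until it
  -- is cleared.
  have hc : ∃ u : ℕ × ℕ, u.1 < 2 ^ w ∧ u.2 < 2 ^ w ∧
      Runs (if 0 + v'.1 * v.2 < 0 + v.1 * v'.2 then replace else .skip) (base i s s' v v' β).stk
        (base i s s' u (betterOf v' v) β).stk (18 * w + 6) := by
    by_cases h : v'.1 * v.2 < v.1 * v'.2
    · refine ⟨(0, 0), by simp, by simp, ?_⟩
      simp only [zero_add, h, if_true, betterOf]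
      exact runs_replace w i s s' v v' β h₁ h₂ h₃ h₄
    · refine ⟨v, h₁, h₂, ?_⟩
      simp only [zero_add, h, if_false, betterOf]
      exact Runs.skip.mono (by omega)
  obtain ⟨u, hu₁, hu₂, hu⟩ := hc
  have r₆ := runs_ifLess (m := w) (a := replace) (b := .skip)
    { base i s s' v v' β with opX := 0 + v'.1 * v.2, opY := 0 + v.1 * v'.2 }
    (show 0 + v'.1 * v.2 < _ by omega) (show 0 + v.1 * v'.2 < _ by omega) hu
  have r₇ := runs_clear_num (d := base i s s' u (betterOf v' v) β) (r := curP) (w := w) rfl hu₁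
  have r₈ := runs_clear_num (d := base i s s' (0, u.2) (betterOf v' v) β) (r := curQ) (w := w)
    rfl hu₂
  have r₉ := Runs.push (s := (base i s s' (0, 0) (betterOf v' v) β).stk) curQ (Γ'.bit true)
  refine (((r₁.seq r₂).seq (r₃.seq (r₄.seq r₅))).seq
    (r₆.seq (r₇.seq (r₈.seq r₉)))).cast ?_ (by nlinarith)
  funext x
  cases x <;> simp [Data.stk, base, digits_zero, digits_one]

end Cmd

/-! ### Evaluation of all scenarios of an instance -/

/-- A scenario as a string. -/
def encodeScenario (cs : List ℚ) : List Γ' := Γ'.bra :: ((cs.map encodeRat).flatten ++ [Γ'.ket])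

theorem length_encodeScenario (cs : List ℚ) : cs.length + 1 ≤ (encodeScenario cs).length := by
  have h : cs.length ≤ (cs.map encodeRat).flatten.length := by
    induction cs with
    | nil => simp
    | cons c cs ih =>
      simp only [List.map_cons, List.flatten_cons, List.length_append, List.length_cons,
        length_encodeRat]
      omega
  simp only [encodeScenario, List.length_cons, List.length_append, List.length_nil]
  omega

/-- Bounds the total number of loop rounds by the input length. -/
theorem length_encodeScenarios (n : ℕ) (css : List (List ℚ)) (h : ∀ cs ∈ css, n = cs.length) :
    css.length * (n + 1) ≤ (css.map encodeScenario).flatten.length := by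
  induction css with
  | nil => simp
  | cons cs css ih =>
    have h₁ := ih fun c hc => h c (by simp [hc])
    have h₂ := length_encodeScenario cs
    rw [← h cs (by simp)] at h₂
    simp only [List.map_cons, List.flatten_cons, List.length_append, List.length_cons]
    nlinarith

namespace Cmd

open Reg

/-- Read and evaluate a scenario. -/
def scenario : Cmd Reg :=
  .seq (.seq (drop inp) (.loop inp isBra item)) (.seq (.seq (drop inp) (move sol' sol)) improve)

/-- `betterOf` returns one of its arguments, so the bound `2 ^ ℓ` does not deteriorate from one
scenario to the next. The width `w` has room for the cross products of the comparison. -/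
theorem runs_scenario {w ℓ : ℕ} (xs : List Bool) (cs : List ℚ) (hlen : xs.length = cs.length)
    (l : List Γ') (v β : ℕ × ℕ) (h₁ : v.1 < 2 ^ ℓ) (h₂ : v.2 < 2 ^ ℓ)
    (hℓ : (encodeScenario cs).length < ℓ) (hw : 2 * ℓ ≤ w) :
    (betterOf v (scenarioValue xs cs)).1 < 2 ^ ℓ ∧ (betterOf v (scenarioValue xs cs)).2 < 2 ^ ℓ ∧
    Runs scenario (base (encodeScenario cs ++ l) (xs.map Γ'.bit) [] (0, 1) v β).stk
      (base l (xs.map Γ'.bit) [] (0, 1) (betterOf v (scenarioValue xs cs)) β).stk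
      (160 * (w + 1) ^ 2 * (xs.length + 1)) := by
  have pw : ∀ {x : ℕ}, x < 2 ^ ℓ → x < 2 ^ w := fun h =>
    h.trans_le (Nat.pow_le_pow_right (by norm_num) (by omega))
  have pm : ∀ {x y : ℕ}, x < 2 ^ ℓ → y < 2 ^ ℓ → x * y < 2 ^ w := fun hx hy =>
    (Nat.mul_lt_mul'' hx hy).trans_le (by
      rw [← pow_add]
      exact Nat.pow_le_pow_right (by norm_num) (by omega))
  have z₁ : (xs.zip cs).map (fun b => Γ'.bit b.1) = xs.map Γ'.bit :=
    List.map_map.symm.trans (congrArg (List.map Γ'.bit) (List.map_fst_zip hlen.le))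
  have z₂ : (xs.zip cs).map (fun b => encodeRat b.2) = cs.map encodeRat :=
    (List.map_map (f := Prod.snd) (g := encodeRat)).symm.trans (congrArg (List.map encodeRat)
      (List.map_snd_zip hlen.ge))
  have z₃ : (xs.zip cs).length = xs.length := by simp [hlen]
  have r₁ := runs_drop (s := (base (encodeScenario cs ++ l) (xs.map Γ'.bit) [] (0, 1) v β).stk) inp
  have hsmall : 1 + ((xs.zip cs).map fun b => encodeRat b.2).flatten.length ≤ ℓ := by
    rw [z₂]
    simp only [encodeScenario, List.length_cons, List.length_append] at hℓ
    omega
  -- Width `ℓ` yields the sharp size bound; the run itself is then taken with width `w`.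
  obtain ⟨g₁, g₂, -⟩ := runs_items ℓ v β l (xs.zip cs) 1 (0, 1) [] [] (by norm_num) (by norm_num)
    hsmall
  obtain ⟨-, -, r₂⟩ := runs_items w v β l (xs.zip cs) 1 (0, 1) [] [] (by norm_num) (by norm_num)
    (by omega)
  rw [z₁, z₂, z₃, List.append_nil, List.append_nil] at r₂
  refine ⟨?_, ?_, ?_⟩
  · unfold betterOf
    split_ifs
    exacts [g₁, h₁]
  · unfold betterOf
    split_ifs
    exacts [g₂, h₂]
  have r₃ := runs_drop
    (s := (base (Γ'.ket :: l) [] (xs.map Γ'.bit).reverse (scenarioValue xs cs) v β).stk) inp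
  have r₄ := runs_move (r := sol') (q := sol) (by simp)
    (s := (base l [] (xs.map Γ'.bit).reverse (scenarioValue xs cs) v β).stk)
  have r₅ := runs_improve (w := w) l (xs.map Γ'.bit) [] (scenarioValue xs cs) v β (pw g₁) (pw g₂)
    (pw h₁) (pw h₂) (pm h₁ g₂) (pm g₁ h₂)
  have r₁' := r₁.cast (s₂ := (base ((cs.map encodeRat).flatten ++ Γ'.ket :: l)
    (xs.map Γ'.bit) [] (0, 1) v β).stk) (by
      funext x
      cases x <;> simp [base, Data.stk, encodeScenario]) le_rfl
  have r₃' := r₃.cast (s₂ := (base l [] (xs.map Γ'.bit).reverse (scenarioValue xs cs) v β).stk) (by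
      funext x
      cases x <;> simp [base, Data.stk]) le_rfl
  have r₄' := r₄.cast (s₂ := (base l (xs.map Γ'.bit) [] (scenarioValue xs cs) v β).stk)
    (T₂ := 3 * xs.length + 1) (by
      funext x
      cases x <;> simp [base, Data.stk]) (by simp [base, Data.stk])
  refine ((r₁'.seq r₂).seq ((r₃'.seq r₄').seq r₅)).mono ?_
  have : 1 ≤ (w + 1) ^ 2 := Nat.one_le_pow _ _ (by omega)
  nlinarith

theorem runs_scenarios {w ℓ : ℕ} (xs : List Bool) (β : ℕ × ℕ) (hw : 2 * ℓ ≤ w)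
    (css : List (List ℚ)) : ∀ v : ℕ × ℕ, (∀ cs ∈ css, xs.length = cs.length) →
    (∀ cs ∈ css, (encodeScenario cs).length < ℓ) → v.1 < 2 ^ ℓ → v.2 < 2 ^ ℓ →
    ((css.map (scenarioValue xs)).foldl betterOf v).1 < 2 ^ ℓ ∧
    ((css.map (scenarioValue xs)).foldl betterOf v).2 < 2 ^ ℓ ∧
    Runs (.loop inp Option.isSome scenario)
      (base (css.map encodeScenario).flatten (xs.map Γ'.bit) [] (0, 1) v β).stk
      (base [] (xs.map Γ'.bit) [] (0, 1) ((css.map (scenarioValue xs)).foldl betterOf v) β).stk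
      (css.length * (160 * (w + 1) ^ 2 * (xs.length + 1) + 1) + 1) := by
  induction css with
  | nil =>
    intro v _ _ h₁ h₂
    exact ⟨h₁, h₂, (Runs.loop_done rfl).mono (by omega)⟩
  | cons cs css ih =>
    intro v hlen hℓ h₁ h₂
    obtain ⟨g₁, g₂, r⟩ := runs_scenario xs cs (hlen cs (by simp))
      (css.map encodeScenario).flatten v β h₁ h₂ (hℓ cs (by simp)) hw
    obtain ⟨k₁, k₂, r'⟩ := ih (betterOf v (scenarioValue xs cs))
      (fun c hc => hlen c (by simp [hc])) (fun c hc => hℓ c (by simp [hc])) g₁ g₂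
    refine ⟨k₁, k₂, (Runs.loop_step ?_ r r').mono ?_⟩
    · simp [base, Data.stk, encodeScenario]
    · simp only [List.length_cons]
      ring_nf
      omega

/-- Read the solution, then evaluate all scenarios. -/
def evaluate : Cmd Reg :=
  .seq (.seq (.seq (moveWhile isBit inp sol') (move sol' sol))
    (.seq (.push curQ (Γ'.bit true)) (.push bestQ (Γ'.bit true))))
    (.loop inp Option.isSome scenario)

theorem runs_evaluate {w ℓ : ℕ} (xs : List Bool) (css : List (List ℚ)) (β : ℕ × ℕ)
    (hlen : ∀ cs ∈ css, xs.length = cs.length)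
    (hℓ : xs.length + (css.map encodeScenario).flatten.length < ℓ) (hw : 2 * ℓ ≤ w) :
    (regretFraction xs css).1 < 2 ^ ℓ ∧ (regretFraction xs css).2 < 2 ^ ℓ ∧
    Runs evaluate
      (base (xs.map Γ'.bit ++ (css.map encodeScenario).flatten) [] [] (0, 0) (0, 0) β).stk
      (base [] (xs.map Γ'.bit) [] (0, 1) (regretFraction xs css) β).stk
      (170 * (w + 1) ^ 2 * ℓ) := by
  have hmem : ∀ cs ∈ css, (encodeScenario cs).length < ℓ := by
    intro cs hcs
    have := List.Sublist.length_le
      (List.sublist_flatten_of_mem (List.mem_map_of_mem (f := encodeScenario) hcs))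
    omega
  obtain ⟨g₁, g₂, r₅⟩ := runs_scenarios (w := w) xs β hw css (0, 1) hlen hmem (by simp)
    (Nat.one_lt_two_pow (by omega))
  refine ⟨g₁, g₂, ?_⟩
  set l := (css.map encodeScenario).flatten with hl
  -- The bits of the solution are followed by an opening bracket or by the end of the input.
  have hhead : isBit l.head? = false := by
    rw [hl]
    cases css <;> rfl
  have r₁ := (runs_moveWhile (r := inp) (q := sol') (by simp) (xs.map Γ'.bit) l
    (fun _ => isBit_of_mem_map) hhead
    (base (xs.map Γ'.bit ++ l) [] [] (0, 0) (0, 0) β).stk rfl).cast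
    (s₂ := (base l [] (xs.map Γ'.bit).reverse (0, 0) (0, 0) β).stk) (T₂ := 3 * xs.length + 1) (by
      funext x
      cases x <;> simp [base, Data.stk]) (by simp)
  have r₂ := (runs_move (r := sol') (q := sol) (by simp)
    (s := (base l [] (xs.map Γ'.bit).reverse (0, 0) (0, 0) β).stk)).cast
    (s₂ := (base l (xs.map Γ'.bit) [] (0, 0) (0, 0) β).stk) (T₂ := 3 * xs.length + 1) (by
      funext x
      cases x <;> simp [base, Data.stk]) (by simp [base, Data.stk])
  have r₃ := (Runs.push (s := (base l (xs.map Γ'.bit) [] (0, 0) (0, 0) β).stk) curQ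
    (Γ'.bit true)).cast (s₂ := (base l (xs.map Γ'.bit) [] (0, 1) (0, 0) β).stk) (by
      funext x
      cases x <;> simp [base, Data.stk, digits_zero, digits_one]) le_rfl
  have r₄ := (Runs.push (s := (base l (xs.map Γ'.bit) [] (0, 1) (0, 0) β).stk) bestQ
    (Γ'.bit true)).cast (s₂ := (base l (xs.map Γ'.bit) [] (0, 1) (0, 1) β).stk) (by
      funext x
      cases x <;> simp [base, Data.stk, digits_zero, digits_one]) le_rfl
  refine (((r₁.seq r₂).seq (r₃.seq r₄)).seq r₅).mono ?_
  have hk := length_encodeScenarios xs.length css hlen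
  rw [← hl] at hk
  have hk' : css.length ≤ css.length * (xs.length + 1) := Nat.le_mul_of_pos_right _ (by omega)
  have hU : 1 ≤ (w + 1) ^ 2 := Nat.one_le_pow _ _ (by omega)
  set U := (w + 1) ^ 2
  set K := css.length * (xs.length + 1) with hK
  have e : css.length * (160 * U * (xs.length + 1) + 1) = 160 * (U * K) + css.length := by
    rw [hK]; ring
  rw [e]
  have e₁ : U * K + U * xs.length + U ≤ U * ℓ := by
    rw [← mul_add, ← Nat.mul_succ]
    exact Nat.mul_le_mul_left _ (by omega)
  have e₂ : K ≤ U * K := Nat.le_mul_of_pos_left _ hU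
  have e₃ : xs.length ≤ U * xs.length := Nat.le_mul_of_pos_left _ hU
  rw [mul_assoc]
  omega

theorem base_stk_eq_single (l : List Γ') :
    (base l [] [] (0, 0) (0, 0) (0, 0)).stk = single inp l := by
  funext x
  cases x <;> simp [base, Data.stk, single, digits_zero]

/-! ### Output of the value -/

/-- Write the value as a fraction. -/
def writeValue : Cmd Reg :=
  .seq (.seq (.seq (clear sol) (clear curQ)) (.seq (.push inp Γ'.ket) (transfer tmp bestQ inp)))
    (.seq (.seq (.push inp Γ'.comma) (transfer tmp bestP inp))
      (.seq (.push inp (Γ'.bit false)) (.push inp Γ'.bra)))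

/-- The string is built from its end, since pushing prepends. The sign bit is constant because the
value is nonnegative. -/
theorem runs_writeValue {w : ℕ} (xs : List Bool) (v : ℕ × ℕ) (hw : xs.length ≤ w)
    (h₁ : v.1 < 2 ^ w) (h₂ : v.2 < 2 ^ w) :
    Runs writeValue (base [] (xs.map Γ'.bit) [] (0, 1) v (0, 0)).stk
      (single inp (encodeFraction v.1 v.2)) (15 * w + 15) := by
  have l₁ := length_digits_le h₁
  have l₂ := length_digits_le h₂
  have r₁ := (runs_clear sol (s := (base [] (xs.map Γ'.bit) [] (0, 1) v (0, 0)).stk)).cast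
    (s₂ := (base [] [] [] (0, 1) v (0, 0)).stk) (T₂ := 3 * w + 1) (by
      funext x
      cases x <;> simp [base, Data.stk]) (by simpa [base, Data.stk] using hw)
  have r₂ := (runs_clear curQ (s := (base [] [] [] (0, 1) v (0, 0)).stk)).cast
    (s₂ := (base [] [] [] (0, 0) v (0, 0)).stk) (T₂ := 4) (by
      funext x
      cases x <;> simp [base, Data.stk, digits_zero]) (by simp [base, Data.stk, digits_one])
  have r₃ := (Runs.push inp Γ'.ket (s := (base [] [] [] (0, 0) v (0, 0)).stk)).cast
    (s₂ := (base [Γ'.ket] [] [] (0, 0) v (0, 0)).stk) (by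
      funext x
      cases x <;> simp [base, Data.stk]) le_rfl
  have r₄ := (runs_transfer (t := tmp) (r := bestQ) (q := inp) (by simp) (by simp) (by simp)
    (s := (base [Γ'.ket] [] [] (0, 0) v (0, 0)).stk) rfl).cast
    (s₂ := (base (digits v.2 ++ [Γ'.ket]) [] [] (0, 0) (v.1, 0) (0, 0)).stk)
    (T₂ := 6 * w + 2) (by
      funext x
      cases x <;> simp [base, Data.stk, digits_zero]) (by simpa [base, Data.stk] using l₂)
  have r₅ := (Runs.push inp Γ'.comma
    (s := (base (digits v.2 ++ [Γ'.ket]) [] [] (0, 0) (v.1, 0) (0, 0)).stk)).cast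
    (s₂ := (base (Γ'.comma :: (digits v.2 ++ [Γ'.ket])) [] [] (0, 0) (v.1, 0) (0, 0)).stk) (by
      funext x
      cases x <;> simp [base, Data.stk]) le_rfl
  have r₆ := (runs_transfer (t := tmp) (r := bestP) (q := inp) (by simp) (by simp) (by simp)
    (s := (base (Γ'.comma :: (digits v.2 ++ [Γ'.ket])) [] [] (0, 0) (v.1, 0) (0, 0)).stk) rfl).cast
    (s₂ := single inp (digits v.1 ++ Γ'.comma :: (digits v.2 ++ [Γ'.ket])))
    (T₂ := 6 * w + 2) (by
      funext x
      cases x <;> simp [base, Data.stk, digits_zero, single]) (by simpa [base, Data.stk] using l₁)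
  refine (((r₁.seq r₂).seq (r₃.seq r₄)).seq ((r₅.seq r₆).seq
    ((Runs.push _ _).seq (Runs.push _ _)))).cast ?_ (by omega)
  have e : ¬((v.1 : ℤ) < 0) := by omega
  simp [single, encodeFraction, map_encodeNat, e]

/-! ### Comparison with a bound -/

/-- Read the bound. -/
def readBound : Cmd Reg :=
  .seq (drop inp) (.switch inp fun s => readFraction (!truth s) bndP bndQ)

/-- The bound, or zero if it is negative, as a fraction. -/
def boundFraction (q : ℚ) : ℕ × ℕ := (if !decide (q.num < 0) then q.num.natAbs else 0, q.den)

theorem runs_readBound (q : ℚ) (l : List Γ') :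
    Runs readBound (single inp (encodeRat q ++ l))
      (base l [] [] (0, 0) (0, 0) (boundFraction q)).stk (6 * (encodeRat q).length + 11) := by
  rw [length_encodeRat, encodeRat_eq]
  refine ((runs_drop inp).seq (Runs.switch ?_)).mono
    (T₁ := 2 + (6 * ((digits q.num.natAbs).length + (digits q.den).length) + 8 + 1)) (by omega)
  have r := runs_readFraction (r := bndP) (q := bndQ)
    (d := base (digits q.num.natAbs ++ Γ'.comma :: (digits q.den ++ Γ'.ket :: l)) [] []
      (0, 0) (0, 0) (0, 0)) (!decide (q.num < 0)) rfl rfl (by simp) rfl rfl _ _ l rfl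
  rw [base_stk_eq_single] at r
  convert r using 1
  · simp [single, truth]
  · simp [single]
  · rfl

/-- Compare the value with the bound. -/
def decideBound : Cmd Reg :=
  .seq (.seq (.seq (prodAdd bestP bndQ) (transfer tmp opZ aux))
      (.seq (prodAdd bndP bestQ) (.seq (transfer tmp opZ opY) (transfer tmp aux opX))))
    (.seq (ifLess (.push inp (Γ'.bit false)) (.push inp (Γ'.bit true)))
      (.seq (.seq (.seq (clear sol) (clear curQ)) (.seq (clear bestP) (clear bestQ)))
        (.seq (clear bndP) (clear bndQ))))

/-- Cross multiplication tests whether the value is strictly below the bound, and the answer is the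
negation. All other stacks are emptied, as halting requires. -/
theorem runs_decideBound {w : ℕ} (xs : List Bool) (v β : ℕ × ℕ) (hw : xs.length ≤ w)
    (h₁ : v.1 < 2 ^ w) (h₂ : v.2 < 2 ^ w) (h₃ : β.1 < 2 ^ w) (h₄ : β.2 < 2 ^ w)
    (h₅ : v.1 * β.2 < 2 ^ w) (h₆ : β.1 * v.2 < 2 ^ w) :
    Runs decideBound (base [] (xs.map Γ'.bit) [] (0, 1) v β).stk
      (single inp [Γ'.bit (decide (β.1 * v.2 ≤ v.1 * β.2))]) (130 * (w + 1) ^ 2) := by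
  set X := xs.map Γ'.bit with hX
  have hXl : X.length = xs.length := by simp [hX]
  have r₁ := runs_prodAdd (w := w) (d := base [] X [] (0, 1) v β) bestP bndQ rfl rfl (by simp)
    (by simp) (by simp) rfl rfl h₁ h₄ (show 0 + v.1 * β.2 < _ by omega)
  have r₂ := runs_transfer_num (w := w) (d := { base [] X [] (0, 1) v β with opZ := 0 + v.1 * β.2 })
    (r := opZ) (q := aux) rfl rfl (by simp) rfl (show 0 + v.1 * β.2 < _ by omega)
  have r₃ := runs_prodAdd (w := w) (d := { base [] X [] (0, 1) v β with aux := 0 + v.1 * β.2 })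
    bndP bestQ rfl rfl (by simp) (by simp) (by simp) rfl rfl h₃ h₂
    (show 0 + β.1 * v.2 < _ by omega)
  have r₄ := runs_transfer_num (w := w)
    (d := { base [] X [] (0, 1) v β with aux := 0 + v.1 * β.2, opZ := 0 + β.1 * v.2 })
    (r := opZ) (q := opY) rfl rfl (by simp) rfl (show 0 + β.1 * v.2 < _ by omega)
  have r₅ := runs_transfer_num (w := w)
    (d := { base [] X [] (0, 1) v β with aux := 0 + v.1 * β.2, opY := 0 + β.1 * v.2 })
    (r := aux) (q := opX) rfl rfl (by simp) rfl (show 0 + v.1 * β.2 < _ by omega)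
  set o := [Γ'.bit (decide (β.1 * v.2 ≤ v.1 * β.2))] with ho
  have hc : Runs (if 0 + v.1 * β.2 < 0 + β.1 * v.2 then .push inp (Γ'.bit false) else
      .push inp (Γ'.bit true)) (base [] X [] (0, 1) v β).stk (base o X [] (0, 1) v β).stk 1 := by
    by_cases h : v.1 * β.2 < β.1 * v.2
    · simp only [zero_add, h, if_true]
      refine (Runs.push _ _).cast ?_ le_rfl
      funext x
      cases x <;> simp [base, Data.stk, ho, h]
    · simp only [zero_add, h, if_false]
      refine (Runs.push _ _).cast ?_ le_rfl
      funext x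
      cases x <;> simp [base, Data.stk, ho, not_lt.1 h]
  have r₆ := runs_ifLess (m := w)
    { base [] X [] (0, 1) v β with opX := 0 + v.1 * β.2, opY := 0 + β.1 * v.2 }
    (show 0 + v.1 * β.2 < _ by omega) (show 0 + β.1 * v.2 < _ by omega) hc
  have r₇ := (runs_clear sol (s := (base o X [] (0, 1) v β).stk)).cast
    (s₂ := (base o [] [] (0, 1) v β).stk) (T₂ := 3 * w + 1) (by
      funext x
      cases x <;> simp [base, Data.stk]) (by
      change 3 * X.length + 1 ≤ _
      omega)
  have r₈ := (runs_clear curQ (s := (base o [] [] (0, 1) v β).stk)).cast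
    (s₂ := (base o [] [] (0, 0) v β).stk) (T₂ := 4) (by
      funext x
      cases x <;> simp [base, Data.stk, digits_zero]) (by simp [base, Data.stk, digits_one])
  have r₉ := runs_clear_num (d := base o [] [] (0, 0) v β) (r := bestP) (w := w) rfl h₁
  have r₁₀ := runs_clear_num (d := base o [] [] (0, 0) (0, v.2) β) (r := bestQ) (w := w) rfl h₂
  have r₁₁ := runs_clear_num (d := base o [] [] (0, 0) (0, 0) β) (r := bndP) (w := w) rfl h₃
  have r₁₂ := runs_clear_num (d := base o [] [] (0, 0) (0, 0) (0, β.2)) (r := bndQ) (w := w)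
    rfl h₄
  rw [← base_stk_eq_single]
  exact (((r₁.seq r₂).seq (r₃.seq (r₄.seq r₅))).seq
    (r₆.seq (((r₇.seq r₈).seq (r₉.seq r₁₀)).seq (r₁₁.seq r₁₂)))).mono (by nlinarith)

end Cmd

/-! ### The closed formula -/

/-- The regret of `x` for the scenario `c`. -/
noncomputable def scenarioRegret {n : ℕ} (c x : Fin n → ℝ) : ℝ :=
  ∑ i, c i * x i - ∑ i, min 0 (c i)

/-- Each coordinate is minimised on its own; the witness selects exactly the negative costs. -/
theorem isLeast_sum_min {n : ℕ} (c : Fin n → ℝ) :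
    IsLeast ((fun y => ∑ i, c i * y i) '' binaryCube n) (∑ i, min 0 (c i)) := by
  constructor
  · refine ⟨fun i => if c i < 0 then 1 else 0, fun i => ?_, Finset.sum_congr rfl fun i _ => ?_⟩
    · by_cases h : c i < 0 <;> simp [h]
    · by_cases h : c i < 0
      · simp [h, h.le]
      · simp [h, not_lt.1 h]
  · rintro _ ⟨y, hy, rfl⟩
    refine Finset.sum_le_sum fun i _ => ?_
    rcases hy i with h | h <;> simp [h]

theorem opt_binaryCube {n : ℕ} (c : Fin n → ℝ) : opt (binaryCube n) c = ∑ i, min 0 (c i) :=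
  (isLeast_sum_min c).csInf_eq

theorem regretValues_range {n k : ℕ} (c : Fin k → Fin n → ℝ) (x : Fin n → ℝ) :
    regretValues (binaryCube n) (Set.range c) x = Set.range fun j => scenarioRegret (c j) x := by
  rw [regretValues, ← Set.range_comp]
  congr 1
  funext j
  simp [scenarioRegret, opt_binaryCube]

theorem isGreatest_sup' {n k : ℕ} (hk : 0 < k) (c : Fin k → Fin n → ℝ) (x : Fin n → ℝ) :
    IsGreatest (regretValues (binaryCube n) (Set.range c) x)
      (Finset.univ.sup' ⟨(⟨0, hk⟩ : Fin k), Finset.mem_univ _⟩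
        fun j => scenarioRegret (c j) x) := by
  rw [regretValues_range]
  constructor
  · obtain ⟨j, -, hj⟩ := Finset.exists_mem_eq_sup' (⟨(⟨0, hk⟩ : Fin k), Finset.mem_univ _⟩)
      fun j => scenarioRegret (c j) x
    exact ⟨j, hj.symm⟩
  · rintro _ ⟨j, rfl⟩
    exact Finset.le_sup' (fun j => scenarioRegret (c j) x) (Finset.mem_univ j)

theorem regret_eq_sup' {n k : ℕ} (hk : 0 < k) (c : Fin k → Fin n → ℝ) (x : Fin n → ℝ) :
    regret (binaryCube n) (Set.range c) x =
      Finset.univ.sup' ⟨(⟨0, hk⟩ : Fin k), Finset.mem_univ _⟩ fun j => scenarioRegret (c j) x :=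
  (isGreatest_sup' hk c x).csSup_eq

theorem scenarioRegret_eq_sum {n : ℕ} (c x : Fin n → ℝ) :
    scenarioRegret c x = ∑ i, (c i * x i - min 0 (c i)) :=
  Finset.sum_sub_distrib (fun i => c i * x i) (fun i => min 0 (c i)) |>.symm

theorem scenarioRegret_nonneg {n : ℕ} (c : Fin n → ℝ) {x : Fin n → ℝ} (hx : x ∈ binaryCube n) :
    0 ≤ scenarioRegret c x := by
  rw [scenarioRegret_eq_sum]
  refine Finset.sum_nonneg fun i _ => ?_
  rcases hx i with h | h <;> simp [h]

/-- A number is the regret if it is an upper bound and attained or zero. -/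
theorem eq_regret {n k : ℕ} (hk : 0 < k) (c : Fin k → Fin n → ℝ) {x : Fin n → ℝ}
    (hx : x ∈ binaryCube n) {v : ℝ} (h₁ : ∀ j, scenarioRegret (c j) x ≤ v)
    (h₂ : v = 0 ∨ ∃ j, v = scenarioRegret (c j) x) :
    regret (binaryCube n) (Set.range c) x = v := by
  rw [regret_eq_sup' hk]
  refine le_antisymm (Finset.sup'_le _ _ fun j _ => h₁ j) ?_
  have hle : ∀ j, scenarioRegret (c j) x ≤ Finset.univ.sup'
      ⟨(⟨0, hk⟩ : Fin k), Finset.mem_univ _⟩ fun j => scenarioRegret (c j) x :=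
    fun j => Finset.le_sup' (fun j => scenarioRegret (c j) x) (Finset.mem_univ j)
  rcases h₂ with rfl | ⟨j, rfl⟩
  · exact (scenarioRegret_nonneg (c ⟨0, hk⟩) hx).trans (hle _)
  · exact hle j

/-! ### The program for the real random access machine -/

/-- The program: index register `2` points to the current coefficient, the registers `3` and `4`
count the coefficients and the scenarios; arithmetic register `0` holds the maximum so far,
register `1` the sum so far, and register `2` holds zero. -/
def regretProgram : List Instr :=
  [.idxCopy 2 0,
    .idxConst 3 0,
    .const 1 0,
    .read 3 2,
    .read 4 3,
    .mul 4 3 4,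
    .add 1 1 4,
    .jumpLt 3 2 9,
    .jump 10,
    .sub 1 1 3,
    .idxSucc 2,
    .idxSucc 3,
    .jumpIdxLt 3 0 3,
    .jumpLt 0 1 15,
    .jump 16,
    -- Adding the zero in register `2` replaces the missing copy instruction for reals.
    .add 0 1 2,
    .idxSucc 4,
    .jumpIdxLt 4 1 1]

/-- The program takes `s` to `s'` in at most `T` steps. -/
def Reach (s s' : Config) (T : ℕ) : Prop := ∃ t ≤ T, (step regretProgram)^[t] s = s'

theorem Reach.trans {s₁ s₂ s₃ : Config} {T₁ T₂ : ℕ} (h₁ : Reach s₁ s₂ T₁) (h₂ : Reach s₂ s₃ T₂) :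
    Reach s₁ s₃ (T₁ + T₂) := by
  obtain ⟨t₁, ht₁, rfl⟩ := h₁
  obtain ⟨t₂, ht₂, rfl⟩ := h₂
  exact ⟨t₂ + t₁, by omega, Function.iterate_add_apply _ _ _ _⟩

theorem Reach.mono {s₁ s₂ : Config} {T₁ T₂ : ℕ} (h : Reach s₁ s₂ T₁) (hT : T₁ ≤ T₂) :
    Reach s₁ s₂ T₂ := by
  obtain ⟨t, ht, hs⟩ := h
  exact ⟨t, ht.trans hT, hs⟩

/-- The state of the program at line `l`. -/
structure RunState (n k : ℕ) (mem : ℕ → ℝ) (l p i j : ℕ) (best acc : ℝ) (s : Config) : Prop where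
  line : s.line = l
  mem : s.mem = mem
  idx0 : s.idx 0 = n
  idx1 : s.idx 1 = k
  idx2 : s.idx 2 = p
  idx3 : s.idx 3 = i
  idx4 : s.idx 4 = j
  reg0 : s.reg 0 = best
  reg1 : s.reg 1 = acc
  reg2 : s.reg 2 = 0

variable {n k : ℕ} {mem : ℕ → ℝ} {p i j : ℕ} {best acc : ℝ} {s : Config}

theorem RunState.item (h : RunState n k mem 3 p i j best acc s) :
    ∃ s', Reach s s' 10 ∧ RunState n k mem (if i + 1 < n then 3 else 13) (p + 1) (i + 1) j best
      (acc + (mem p * mem i - min 0 (mem p))) s' := by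
  obtain ⟨line, idx, reg, mem'⟩ := s
  obtain ⟨h0, h1, h2, h3, h4, h5, h6, h7, h8, h9⟩ := h
  simp only at h0 h1 h2 h3 h4 h5 h6 h7 h8 h9
  subst h0 h1
  by_cases hc : mem' p < 0
  -- Subtracting and jumping over the subtraction cost one instruction each, so both cases take nine
  -- steps.
  · refine ⟨_, ⟨9, by norm_num, rfl⟩, ?_⟩
    simp only [Function.iterate_succ_apply, Function.iterate_zero_apply]
    constructor <;> simp [step, regretProgram, Instr.exec, *]
    simp [hc.le]
    ring
  · refine ⟨_, ⟨9, by norm_num, rfl⟩, ?_⟩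
    simp only [Function.iterate_succ_apply, Function.iterate_zero_apply]
    constructor <;> simp [step, regretProgram, Instr.exec, *]
    simp [not_lt.1 hc]

theorem RunState.update (h : RunState n k mem 13 p i j best acc s) :
    ∃ s', Reach s s' 5 ∧ RunState n k mem (if j + 1 < k then 1 else 18) p i (j + 1)
      (max best acc) acc s' := by
  obtain ⟨line, idx, reg, mem'⟩ := s
  obtain ⟨h0, h1, h2, h3, h4, h5, h6, h7, h8, h9⟩ := h
  simp only at h0 h1 h2 h3 h4 h5 h6 h7 h8 h9
  subst h0 h1
  by_cases hc : best < acc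
  · refine ⟨_, ⟨4, by norm_num, rfl⟩, ?_⟩
    simp only [Function.iterate_succ_apply, Function.iterate_zero_apply]
    constructor <;> simp [step, regretProgram, Instr.exec, *]
    exact hc.le
  · refine ⟨_, ⟨4, by norm_num, rfl⟩, ?_⟩
    simp only [Function.iterate_succ_apply, Function.iterate_zero_apply]
    constructor <;> simp [step, regretProgram, Instr.exec, *]
    exact not_lt.1 hc

theorem RunState.start (h : RunState n k mem 1 p i j best acc s) :
    ∃ s', Reach s s' 2 ∧ RunState n k mem 3 p 0 j best 0 s' := by
  obtain ⟨line, idx, reg, mem'⟩ := s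
  obtain ⟨h0, h1, h2, h3, h4, h5, h6, h7, h8, h9⟩ := h
  simp only at h0 h1 h2 h3 h4 h5 h6 h7 h8 h9
  subst h0 h1
  refine ⟨_, ⟨2, le_rfl, rfl⟩, ?_⟩
  simp only [Function.iterate_succ_apply, Function.iterate_zero_apply]
  constructor <;> simp [step, regretProgram, Instr.exec, *]

/-- The loop is tested at its end, so its body runs at least once; hence `m + 1` remaining items. -/
theorem RunState.items (m : ℕ) : ∀ {p i : ℕ} {acc : ℝ} {s : Config}, i + (m + 1) = n →
    RunState n k mem 3 p i j best acc s →
    ∃ s', Reach s s' (10 * (m + 1)) ∧ RunState n k mem 13 (p + (m + 1)) n j best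
      (acc + ∑ a ∈ Finset.range (m + 1),
        (mem (p + a) * mem (i + a) - min 0 (mem (p + a)))) s' := by
  induction m with
  | zero =>
    intro p i acc s hi h
    obtain ⟨s', hr, hs⟩ := h.item
    refine ⟨s', hr, ?_⟩
    rw [if_neg (by omega)] at hs
    subst hi
    simpa using hs
  | succ m ih =>
    intro p i acc s hi h
    obtain ⟨s₁, hr₁, hs₁⟩ := h.item
    rw [if_pos (by omega)] at hs₁
    obtain ⟨s₂, hr₂, hs₂⟩ := ih (by omega) hs₁
    refine ⟨s₂, (hr₁.trans hr₂).mono (by omega), ?_⟩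
    rw [Finset.sum_range_succ']
    convert hs₂ using 1
    · omega
    · rw [add_assoc, add_comm (_ - _)]
      simp [add_assoc, add_comm 1]

/-- The coefficient pointer is never reset: scenarios are stored consecutively behind `x`, so
scenario `j` starts at `n + j * n`. The conclusion has the shape that `eq_regret` needs. -/
theorem RunState.scenarios (hn : 0 < n) (g : ℕ → ℝ)
    (hg : ∀ j < k, g j = ∑ a ∈ Finset.range n,
      (mem (n + j * n + a) * mem a - min 0 (mem (n + j * n + a)))) (m : ℕ) :
    ∀ {i j : ℕ} {best acc : ℝ} {s : Config}, j + (m + 1) = k →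
    RunState n k mem 1 (n + j * n) i j best acc s →
    ∃ s' v, Reach s s' ((10 * n + 7) * (m + 1)) ∧ s'.line = 18 ∧ s'.reg 0 = v ∧
      best ≤ v ∧ (∀ a, j ≤ a → a < k → g a ≤ v) ∧ (v = best ∨ ∃ a < k, v = g a) := by
  have hone : ∀ {i j : ℕ} {best acc : ℝ} {s : Config}, j < k →
      RunState n k mem 1 (n + j * n) i j best acc s →
      ∃ s', Reach s s' (10 * n + 7) ∧ RunState n k mem (if j + 1 < k then 1 else 18)
        (n + (j + 1) * n) n (j + 1) (max best (g j)) (g j) s' := by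
    intro i j best acc s hj h
    obtain ⟨s₁, hr₁, hs₁⟩ := h.start
    obtain ⟨m, rfl⟩ : ∃ m, n = m + 1 := ⟨n - 1, by omega⟩
    obtain ⟨s₂, hr₂, hs₂⟩ := hs₁.items m (by omega)
    obtain ⟨s₃, hr₃, hs₃⟩ := hs₂.update
    refine ⟨s₃, ((hr₁.trans hr₂).trans hr₃).mono (by omega), ?_⟩
    rw [hg j hj]
    simp only [zero_add] at hs₃
    rw [show m + 1 + (j + 1) * (m + 1) = m + 1 + j * (m + 1) + (m + 1) by ring]
    exact hs₃
  induction m with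
  | zero =>
    intro i j best acc s hj h
    obtain ⟨s', hr, hs⟩ := hone (by omega) h
    rw [if_neg (by omega)] at hs
    refine ⟨s', _, hr.mono (by omega), hs.line, hs.reg0, le_max_left _ _, fun a ha ha' => ?_, ?_⟩
    · obtain rfl : a = j := by omega
      exact le_max_right _ _
    · rcases max_choice best (g j) with e | e
      · exact Or.inl e
      · exact Or.inr ⟨j, by omega, e⟩
  | succ m ih =>
    intro i j best acc s hj h
    obtain ⟨s₁, hr₁, hs₁⟩ := hone (by omega) h
    rw [if_pos (by omega)] at hs₁
    obtain ⟨s₂, v, hr₂, hl, hv, hb, hle, hor⟩ := ih (by omega) hs₁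
    refine ⟨s₂, v, (hr₁.trans hr₂).mono (by ring_nf; omega), hl, hv,
      (le_max_left _ _).trans hb, fun a ha ha' => ?_, ?_⟩
    · rcases ha.eq_or_lt with rfl | ha
      · exact (le_max_right _ _).trans hb
      · exact hle a ha ha'
    · rcases hor with e | e
      · rcases max_choice best (g j) with e' | e'
        · exact Or.inl (e.trans e')
        · exact Or.inr ⟨j, by omega, e.trans e'⟩
      · exact Or.inr e

theorem initConfig_mem_sol (c : Fin k → Fin n → ℝ) (x : Fin n → ℝ) (i : Fin n) :
    (initConfig c x).mem i = x i := by
  simp [initConfig]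

theorem initConfig_mem_cost (c : Fin k → Fin n → ℝ) (x : Fin n → ℝ) (j : Fin k) (i : Fin n) :
    (initConfig c x).mem (n + j * n + i) = c j i := by
  have h : (j : ℕ) * n + i < k * n := by
    calc (j : ℕ) * n + i < j * n + n := by omega
      _ = (j + 1) * n := by ring
      _ ≤ k * n := Nat.mul_le_mul_right _ j.2
  have e : (⟨n + j * n + i - n, by omega⟩ : Fin (k * n)) = finProdFinEquiv (j, i) := by
    ext
    simp only [finProdFinEquiv_apply_val]
    rw [mul_comm n]
    omega
  have h₁ : ¬(n + (j : ℕ) * n + i < n) := by omega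
  have h₂ : n + (j : ℕ) * n + i - n < k * n := by omega
  simp only [initConfig, h₁, h₂, dif_pos, dif_neg, not_false_eq_true]
  rw [e, Equiv.symm_apply_apply]

theorem outputsWithin_regretProgram (hn : 0 < n) (hk : 0 < k) (c : Fin k → Fin n → ℝ)
    {x : Fin n → ℝ} (hx : x ∈ binaryCube n) :
    OutputsWithin regretProgram (initConfig c x) (regret (binaryCube n) (Set.range c) x)
      (18 * (n * k)) := by
  have h₀ : ∃ s, Reach (initConfig c x) s 1 ∧
      RunState n k (initConfig c x).mem 1 (n + 0 * n) 0 0 0 0 s := by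
    refine ⟨_, ⟨1, le_rfl, rfl⟩, ?_⟩
    constructor <;> simp [step, regretProgram, Instr.exec, initConfig]
  obtain ⟨s, hr, hs⟩ := h₀
  set g : ℕ → ℝ := fun j => if h : j < k then scenarioRegret (c ⟨j, h⟩) x else 0 with hg
  have hgj : ∀ j : Fin k, g j = scenarioRegret (c j) x := fun j => by simp [hg]
  obtain ⟨s', v, hr', hl, hv, -, hle, hor⟩ := hs.scenarios hn g (by
    intro j hj
    rw [hgj ⟨j, hj⟩, scenarioRegret_eq_sum, Finset.sum_range]
    refine Finset.sum_congr rfl fun i _ => ?_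
    rw [← initConfig_mem_cost c x ⟨j, hj⟩ i, ← initConfig_mem_sol c x i]) (k - 1) (by omega)
  obtain ⟨t, ht, rfl⟩ := hr.trans hr'
  refine ⟨t, ht.trans ?_, ?_, ?_⟩
  · rw [Nat.sub_add_cancel hk]
    -- The total is `1 + (10 * n + 7) * k`; as `n` and `k` are positive, both `1` and `k` are at
    -- most `n * k`, which gives `18`.
    nlinarith [Nat.mul_le_mul hn hk]
  · rw [Halted, hl]
    rfl
  · rw [hv, eq_regret hk c hx]
    · intro j
      rw [← hgj]
      exact hle j (by omega) j.2
    · rcases hor with e | ⟨a, ha, e⟩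
      · exact Or.inl e
      · exact Or.inr ⟨⟨a, ha⟩, e.trans (hgj ⟨a, ha⟩)⟩

/-! ### The value of the computed fraction -/

/-- The real value of a fraction. -/
noncomputable def fracVal (v : ℕ × ℕ) : ℝ := (v.1 : ℝ) / (v.2 : ℝ)

theorem fracVal_lt_iff {v w : ℕ × ℕ} (hv : 0 < v.2) (hw : 0 < w.2) :
    v.1 * w.2 < w.1 * v.2 ↔ fracVal v < fracVal w := by
  have hv' : (0 : ℝ) < v.2 := by exact_mod_cast hv
  have hw' : (0 : ℝ) < w.2 := by exact_mod_cast hw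
  rw [fracVal, fracVal, div_lt_div_iff₀ hv' hw']
  exact_mod_cast Iff.rfl

/-- The optimal bit is 1 exactly for a negative cost, so the exclusive or detects a deviation from
it, which costs the absolute value. -/
theorem takenNum_div_den (b : Bool × ℚ) :
    (takenNum b : ℝ) / (b.2.den : ℝ) = (b.2 : ℝ) * (if b.1 then 1 else 0) - min 0 (b.2 : ℝ) := by
  obtain ⟨x, q⟩ := b
  have hq : (q : ℝ) = (q.num : ℝ) / (q.den : ℝ) := by exact_mod_cast (Rat.num_div_den q).symm
  have habs : (q.num.natAbs : ℝ) = |(q.num : ℝ)| := by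
    rw [← Int.cast_abs, Int.abs_eq_natAbs]
    rfl
  by_cases h : q.num < 0
  · have hneg : (q : ℝ) < 0 := by exact_mod_cast Rat.num_neg.1 h
    have hn : (q.num : ℝ) < 0 := by exact_mod_cast h
    have e : |(q.num : ℝ)| / q.den = -(q : ℝ) := by rw [abs_of_neg hn, hq, neg_div]
    cases x <;> simp only [takenNum, h, min_eq_right hneg.le] <;> simp [habs, e]
  · have hpos : (0 : ℝ) ≤ q := by exact_mod_cast Rat.num_nonneg.1 (not_lt.1 h)
    have hn : (0 : ℝ) ≤ (q.num : ℝ) := by exact_mod_cast not_lt.1 h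
    have e : |(q.num : ℝ)| / q.den = (q : ℝ) := by rw [abs_of_nonneg hn, hq]
    cases x <;> simp only [takenNum, h, min_eq_left hpos] <;> simp [habs, e]

theorem fracVal_foldl_itemStep (bs : List (Bool × ℚ)) : ∀ v : ℕ × ℕ, 0 < v.2 →
    0 < (bs.foldl itemStep v).2 ∧ fracVal (bs.foldl itemStep v) = fracVal v +
      (bs.map fun b => (b.2 : ℝ) * (if b.1 then 1 else 0) - min 0 (b.2 : ℝ)).sum := by
  induction bs with
  | nil => simp
  | cons b bs ih =>
    intro v hv
    have hb := b.2.den_pos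
    obtain ⟨h₁, h₂⟩ := ih (itemStep v b) (Nat.mul_pos hv hb)
    refine ⟨h₁, ?_⟩
    rw [List.foldl_cons, h₂, List.map_cons, List.sum_cons, ← takenNum_div_den, ← add_assoc]
    congr 1
    have hv' : (v.2 : ℝ) ≠ 0 := by exact_mod_cast hv.ne'
    have hb' : (b.2.den : ℝ) ≠ 0 := by exact_mod_cast hb.ne'
    simp only [fracVal, itemStep, Nat.cast_add, Nat.cast_mul]
    field_simp

theorem fracVal_scenarioValue {n : ℕ} (x : Fin n → Bool) (c : Fin n → ℚ) :
    0 < (scenarioValue (List.ofFn x) (List.ofFn c)).2 ∧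
    fracVal (scenarioValue (List.ofFn x) (List.ofFn c)) =
      scenarioRegret (fun i => (c i : ℝ)) (fun i => if x i then 1 else 0) := by
  obtain ⟨h₁, h₂⟩ := fracVal_foldl_itemStep ((List.ofFn x).zip (List.ofFn c)) (0, 1) (by simp)
  refine ⟨h₁, h₂.trans ?_⟩
  have e : (List.ofFn x).zip (List.ofFn c) = List.ofFn fun i => (x i, c i) := by
    apply List.ext_getElem <;> simp
  rw [e, List.map_ofFn, List.sum_ofFn, scenarioRegret_eq_sum]
  simp [fracVal]

/-- Positive denominators make cross multiplication agree with the order of the real values. -/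
theorem foldl_betterOf (vs : List (ℕ × ℕ)) : ∀ v : ℕ × ℕ, 0 < v.2 → (∀ w ∈ vs, 0 < w.2) →
    0 < (vs.foldl betterOf v).2 ∧ fracVal v ≤ fracVal (vs.foldl betterOf v) ∧
    (∀ w ∈ vs, fracVal w ≤ fracVal (vs.foldl betterOf v)) ∧
    (vs.foldl betterOf v = v ∨ vs.foldl betterOf v ∈ vs) := by
  induction vs with
  | nil => simp
  | cons w vs ih =>
    intro v hv hvs
    have hw := hvs w (by simp)
    have hb : 0 < (betterOf v w).2 ∧ fracVal v ≤ fracVal (betterOf v w) ∧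
        fracVal w ≤ fracVal (betterOf v w) ∧ (betterOf v w = v ∨ betterOf v w = w) := by
      unfold betterOf
      by_cases h : v.1 * w.2 < w.1 * v.2
      · simpa [h, hw] using ((fracVal_lt_iff hv hw).1 h).le
      · simpa [h, hv] using not_lt.1 fun h' => h ((fracVal_lt_iff hv hw).2 h')
    obtain ⟨h₁, h₂, h₃, h₄⟩ := hb
    obtain ⟨k₁, k₂, k₃, k₄⟩ := ih (betterOf v w) h₁ fun u hu => hvs u (by simp [hu])
    refine ⟨k₁, h₂.trans k₂, fun u hu => ?_, ?_⟩
    · rcases List.mem_cons.1 hu with rfl | hu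
      · exact h₃.trans k₂
      · exact k₃ u hu
    · rcases k₄ with k₄ | k₄
      · rcases h₄ with h₄ | h₄
        · exact Or.inl (k₄.trans h₄)
        · exact Or.inr (List.mem_cons.2 (Or.inl (k₄.trans h₄)))
      · exact Or.inr (List.mem_cons_of_mem _ k₄)

/-! ### Instances as lists, and the two polynomial-time statements -/

namespace EvalInstance

/-- The bits of the solution. -/
def solution (I : EvalInstance) : List Bool := List.ofFn I.x

/-- The list of the scenarios. -/
def scenarios (I : EvalInstance) : List (List ℚ) := List.ofFn fun j => List.ofFn (I.c j)

/-- The regret as a fraction. -/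
def value (I : EvalInstance) : ℕ × ℕ := regretFraction I.solution I.scenarios

theorem value_spec (I : EvalInstance) : 0 < I.value.2 ∧ I.regret = fracVal I.value := by
  have hj : ∀ j, 0 < (scenarioValue I.solution (List.ofFn (I.c j))).2 ∧
      fracVal (scenarioValue I.solution (List.ofFn (I.c j))) =
        scenarioRegret (fun i => (I.c j i : ℝ)) (fun i => if I.x i then 1 else 0) :=
    fun j => fracVal_scenarioValue I.x (I.c j)
  have hm : ∀ w ∈ I.scenarios.map (scenarioValue I.solution),
      ∃ j, scenarioValue I.solution (List.ofFn (I.c j)) = w := by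
    intro w hw
    simpa [scenarios, List.map_ofFn, List.mem_ofFn] using hw
  obtain ⟨h₁, -, h₃, h₄⟩ := foldl_betterOf (I.scenarios.map (scenarioValue I.solution)) (0, 1)
    (by simp) (by
      intro w hw
      obtain ⟨j, rfl⟩ := hm w hw
      exact (hj j).1)
  refine ⟨h₁, eq_regret I.k_pos (fun j i => (I.c j i : ℝ)) (fun i => ?_) (fun j => ?_) ?_⟩
  · cases I.x i <;> simp
  · rw [← (hj j).2]
    refine h₃ _ (List.mem_map_of_mem ?_)
    simp [scenarios, List.mem_ofFn]
  · rcases h₄ with h₄ | h₄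
    · left
      rw [value, regretFraction, h₄]
      simp [fracVal]
    · right
      obtain ⟨j, e⟩ := hm _ h₄
      refine ⟨j, ?_⟩
      rw [← (hj j).2, e]
      rfl

theorem encode_eq (I : EvalInstance) : I.encode =
    I.solution.map Γ'.bit ++ (I.scenarios.map encodeScenario).flatten := by
  simp only [encode, solution, scenarios, List.map_ofFn]
  congr 3
  funext j
  simp [encodeScenario, List.map_ofFn, Function.comp_def]

theorem length_encode (I : EvalInstance) : I.encode.length =
    I.solution.length + (I.scenarios.map encodeScenario).flatten.length := by
  rw [encode_eq, List.length_append, List.length_map]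

theorem length_of_mem_scenarios (I : EvalInstance) :
    ∀ cs ∈ I.scenarios, I.solution.length = cs.length := by
  intro cs hcs
  obtain ⟨j, rfl⟩ : ∃ j, List.ofFn (I.c j) = cs := by
    simpa [scenarios, List.mem_ofFn] using hcs
  simp [solution]

open Cmd Reg

theorem polyTimeComputable_value :
    PolyTimeComputable EvalInstance.encode (fun v => encodeFraction v.1 v.2)
      (fun I => ((I.value.1 : ℤ), I.value.2)) := by
  refine polyTimeComputable_of_runs (.seq evaluate writeValue) inp inp
    -- For input length `X` the bounds are used with `ℓ = X + 1` and `w = 2 * ℓ`, so `w + 1 = 2 * X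
    -- + 3`; the constant also absorbs the output phase.
    (200 * (2 * Polynomial.X + 3) ^ 2 * (Polynomial.X + 1)) fun I => ?_
  have hℓ : I.solution.length + (I.scenarios.map encodeScenario).flatten.length <
      I.encode.length + 1 := by
    rw [length_encode]
    omega
  obtain ⟨h₁, h₂, r⟩ := runs_evaluate (w := 2 * (I.encode.length + 1)) I.solution I.scenarios
    (0, 0) I.length_of_mem_scenarios hℓ le_rfl
  have pw : ∀ {x : ℕ}, x < 2 ^ (I.encode.length + 1) → x < 2 ^ (2 * (I.encode.length + 1)) :=
    fun h => h.trans_le (Nat.pow_le_pow_right (by norm_num) (by omega))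
  have r' := runs_writeValue (w := 2 * (I.encode.length + 1)) I.solution I.value (by omega)
    (pw h₁) (pw h₂)
  rw [← encode_eq, base_stk_eq_single] at r
  refine (r.seq r').mono ?_
  simp only [Polynomial.eval_mul, Polynomial.eval_add, Polynomial.eval_pow, Polynomial.eval_X,
    Polynomial.eval_ofNat, Polynomial.eval_one]
  nlinarith

/-- Fractions of natural numbers are nonnegative, so a negative bound may be replaced by zero and
signs never enter the comparison. -/
theorem boundFraction_le_iff (q : ℚ) {v : ℕ × ℕ} (hv : 0 < v.2) :
    (boundFraction q).1 * v.2 ≤ v.1 * (boundFraction q).2 ↔ (q : ℝ) ≤ fracVal v := by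
  have hq : (q : ℝ) = (q.num : ℝ) / (q.den : ℝ) := by exact_mod_cast (Rat.num_div_den q).symm
  by_cases h : q.num < 0
  · have hneg : (q : ℝ) < 0 := by exact_mod_cast Rat.num_neg.1 h
    have h0 : 0 ≤ fracVal v := div_nonneg (Nat.cast_nonneg _) (Nat.cast_nonneg _)
    simp only [boundFraction, h]
    simp [hneg.le.trans h0]
  · have e : (q : ℝ) = fracVal (boundFraction q) := by
      rw [hq, fracVal]
      simp only [boundFraction, h]
      have : (q.num.natAbs : ℝ) = (q.num : ℝ) := by
        rw [← Int.cast_natCast, Int.natAbs_of_nonneg (not_lt.1 h)]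
      simp [this]
    rw [e, ← not_lt, ← not_lt, fracVal_lt_iff hv q.den_pos]

theorem inP_le_regret :
    InP (fun p : EvalInstance × ℚ => encodeRat p.2 ++ p.1.encode)
      (fun p => (p.2 : ℝ) ≤ p.1.regret) := by
  refine inP_of_runs (.seq readBound (.seq evaluate decideBound)) inp inp
    (400 * (2 * Polynomial.X + 3) ^ 2 * (Polynomial.X + 1))
    (fun p => decide ((boundFraction p.2).1 * p.1.value.2 ≤ p.1.value.1 * (boundFraction p.2).2))
    (fun p => ?_) fun p => ?_
  · rw [decide_eq_true_iff, p.1.value_spec.2]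
    exact boundFraction_le_iff p.2 p.1.value_spec.1
  · obtain ⟨I, q⟩ := p
    simp only
    -- The length includes the bound, so its numerator and denominator also stay below `2 ^ (N +
    -- 1)`.
    set N := (encodeRat q ++ I.encode).length with hN
    have hN' : N = (encodeRat q).length + I.encode.length := by rw [hN, List.length_append]
    have hℓ : I.solution.length + (I.scenarios.map encodeScenario).flatten.length < N + 1 := by
      rw [← length_encode]
      omega
    obtain ⟨h₁, h₂, r⟩ := runs_evaluate (w := 2 * (N + 1)) I.solution I.scenarios
      (boundFraction q) I.length_of_mem_scenarios hℓ le_rfl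
    have pw : ∀ {x k : ℕ}, x < 2 ^ k → k ≤ N + 1 → x < 2 ^ (N + 1) := fun h h' =>
      h.trans_le (Nat.pow_le_pow_right (by norm_num) h')
    have hlen := length_encodeRat q
    have h₃ : (boundFraction q).1 < 2 ^ (N + 1) := by
      unfold boundFraction
      split_ifs
      · exact pw (lt_two_pow_length_digits q.num.natAbs) (by omega)
      · positivity
    have h₄ : (boundFraction q).2 < 2 ^ (N + 1) := pw (lt_two_pow_length_digits q.den) (by omega)
    have pw' : ∀ {x : ℕ}, x < 2 ^ (N + 1) → x < 2 ^ (2 * (N + 1)) := fun h =>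
      h.trans_le (Nat.pow_le_pow_right (by norm_num) (by omega))
    have pm : ∀ {x y : ℕ}, x < 2 ^ (N + 1) → y < 2 ^ (N + 1) → x * y < 2 ^ (2 * (N + 1)) :=
      fun hx hy => (Nat.mul_lt_mul'' hx hy).trans_le (by rw [← pow_add, two_mul])
    have r' := runs_decideBound (w := 2 * (N + 1)) I.solution I.value (boundFraction q)
      (by omega) (pw' h₁) (pw' h₂) (pw' h₃) (pw' h₄) (pm h₁ h₄) (pm h₃ h₂)
    have r'' := runs_readBound q I.encode
    rw [← encode_eq] at r
    refine (r''.seq (r.seq r')).mono ?_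
    simp only [Polynomial.eval_mul, Polynomial.eval_add, Polynomial.eval_pow, Polynomial.eval_X,
      Polynomial.eval_ofNat, Polynomial.eval_one]
    nlinarith

end EvalInstance

end MinmaxRegret

theorem mainTheorem10 :
    -- the closed formula, with all minima and maxima attained
    (∀ (n k : ℕ) (hk : 0 < k) (c : Fin k → Fin n → ℝ) (x : Fin n → ℝ), x ∈ binaryCube n →
      (∀ j, IsLeast ((fun y => ∑ i, c j i * y i) '' binaryCube n) (opt (binaryCube n) (c j))) ∧
      IsGreatest (regretValues (binaryCube n) (Set.range c) x)
        (regret (binaryCube n) (Set.range c) x) ∧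
      regret (binaryCube n) (Set.range c) x =
        Finset.univ.sup' ⟨(⟨0, hk⟩ : Fin k), Finset.mem_univ _⟩
          (fun j => ∑ i, c j i * x i - ∑ i, min 0 (c j i))) ∧
    -- one program evaluates the regret with `O(n k)` elementary operations
    (∃ (P : List Instr) (C : ℕ), ∀ (n k : ℕ), 0 < n → 0 < k →
      ∀ (c : Fin k → Fin n → ℝ) (x : Fin n → ℝ), x ∈ binaryCube n →
        OutputsWithin P (initConfig c x) (regret (binaryCube n) (Set.range c) x)
          (C * (n * k))) ∧
    -- for rational data, the value is computable in polynomial time on a Turing machine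
    (∃ f : EvalInstance → ℤ × ℕ,
      PolyTimeComputable EvalInstance.encode (fun v => encodeFraction v.1 v.2) f ∧
      ∀ I : EvalInstance, 0 < (f I).2 ∧ I.regret = ((f I).1 : ℝ) / ((f I).2 : ℝ)) ∧
    -- for rational data, deciding whether the regret reaches a given bound is in P
    InP (fun p : EvalInstance × ℚ => encodeRat p.2 ++ p.1.encode)
      (fun p => (p.2 : ℝ) ≤ p.1.regret) := by
  refine ⟨fun n k hk c x _ => ⟨fun j => ?_, ?_, regret_eq_sup' hk c x⟩,
    ⟨regretProgram, 18, fun n k hn hk c x hx => outputsWithin_regretProgram hn hk c hx⟩,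
    ⟨fun I => ((I.value.1 : ℤ), I.value.2), EvalInstance.polyTimeComputable_value,
      fun I => ⟨I.value_spec.1, I.value_spec.2⟩⟩, EvalInstance.inP_le_regret⟩
  · rw [opt_binaryCube]
    exact isLeast_sum_min (c j)
  · rw [regret_eq_sup' hk c x]
    exact isGreatest_sup' hk c x
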